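/- **Proposition 6.5.** Throughout, graphs are finite and simple and $\mathbb N=\{1,2,\dots\}$. *Definitions.* Let $G$ be a graph. For $A,B\subset V(G)$ disjoint let $d(A,B)=e(A,B)/(|A||B|)$ (and $d(A,B)=0$ if $A$ or $B$ is empty). The pair $(A,B)$ is $(\varepsilon,d)$-regular if $d(A,B)\ge d$ and $|d(A',B')-d(A,B)|<\varepsilon$ for all $A'\subset A$, $B'\subset B$ with $|A'|\ge\varepsilon|A|$, $|B'|\ge\varepsilon|B|$. For $r\ge 3$, $\ell,t\in\mathbb N$ and $Y\subset V(G)$, let $\mathcal F_\ell^{r,t}(Y)$ be the set of all families $S$ consisting of $t$-element subsets $S_I$ ($I\subset[\ell]$) and $S'_j$ ($j\in[r-3]$) of $Y$ that are pairwise disjoint and such that $G$ contains all edges between $S'_j$ and $S_I$ for all $I,j$, and all edges between $S'_j$ and $S'_{j'}$ for all $j\ne j'$. For an edge $e$ of $G$ and $i\in[\ell]$ write $e\to_i S$ if the ends of $e$ can be named $x,y$ so that every $S'_j$ is contained in $N(x)\cap N(y)$, $S_I\subset N(x)$ whenever $i\in I$, and $S_I\subset N(y)$ whenever $i\notin I$.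 For $X\subset V(G)$, $C\in\mathbb N$ and $\alpha>0$, a family $S\in\mathcal F_\ell^{r,t}(Y)$ is $(r,\ell,t,C,\alpha)$-good for $(X,Y)$ if there are sets $E_1,\dots,E_\ell$ of edges of $G[X]$, such that for each $j$ the graph formed by the edges of $E_j$ and their endpoints has average degree at least $2^{-\ell}\alpha C$, and such that for all $e_1\in E_1,\dots,e_\ell\in E_\ell$ we have $e_i\to_i S$ for every $i\in[\ell]$. The pair $(X,Y)$ is $(C,\alpha)$-dense in copies of $Z_\ell^{r,t}$ if at least $2^{-\ell}\alpha|Y|^{(2^\ell+r-3)t}$ families $S\in\mathcal F_\ell^{r,t}(Y)$ are $(r,\ell,t,C,\alpha)$-good for $(X,Y)$. *Statement.* For every integer $r>3$, all $\ell,t\in\mathbb N$ and all reals $d,\gamma>0$ there exist $\ell^*,t^*\in\mathbb N$ such that for every $\alpha>0$ and $C\in\mathbb N$ there exist $\varepsilon_1>0$ and $C^*\in\mathbb N$ such that for every $0<\varepsilon<\varepsilon_1$ the following holds. Let $G$ be a graph, and let $X$, $Y$ and $Z_1,\dots,Z_{r-3}$ be pairwise disjoint subsets of $V(G)$ with $|Y|=|Z_j|$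 for each $j\in[r-3]$. Let $Z:=Z_1\cup\dots\cup Z_{r-3}$. Suppose that $(Y,Z_j)$ is $(\varepsilon,d)$-regular for each $j$, that $(Z_i,Z_j)$ is $(\varepsilon,d)$-regular for all $i\neq j$, and that $|N(x)\cap Z_j|\ge\left(\tfrac12+\gamma\right)|Z_j|$ for every $x\in X$ and $j\in[r-3]$. If $(X,Y)$ is $(C^*,\alpha)$-dense in copies of $Z_{\ell^*}^{3,t^*}$, then there is some $S\in\mathcal F_\ell^{r,t}(Y\cup Z)$ that is $(r,\ell,t,C,\alpha)$-good for $(X,Y\cup Z)$. -/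

import Mathlib

namespace Zykov

/-- `(A, B)` is `(ε, d)`-regular: it is `ε`-regular (`|d(A', B') - d(A, B)| < ε` for all `A' ⊆ A`,
`B' ⊆ B` with `|A'| ≥ ε |A|`, `|B'| ≥ ε |B|`) and its density `d(A, B) = e(A, B) / (|A| |B|)` is
at least `d`. The density of a pair with an empty member is `0`. -/
def IsRegularPair {V : Type*} (G : SimpleGraph V) [DecidableRel G.Adj] (ε d : ℝ)
    (A B : Finset V) : Prop :=
  G.IsUniform ε A B ∧ d ≤ (G.edgeDensity A B : ℝ)

/-- A function on `2^[ℓ] ∪ [r-3]` whose values are vertex sets. The set `S_I` is `S (Sum.inl I)`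
and the set `S'_j` is `S (Sum.inr j)`. -/
abbrev Family (V : Type*) (r ℓ : ℕ) : Type _ :=
  Finset (Fin ℓ) ⊕ Fin (r - 3) → Finset V

/-- The collection of proper functions `S : 2^[ℓ] ∪ [r-3] → (Y choose t)`: the `t`-subsets
`S_I`, `S'_j` of `Y` are pairwise disjoint, each `S'_j` is completely joined to each `S_I`, and
`S'_j`, `S'_{j'}` are completely joined to each other whenever `j ≠ j'`. -/
def properFamilies {V : Type*} (G : SimpleGraph V) (r ℓ t : ℕ) (Y : Finset V) :
    Set (Family V r ℓ) :=
  {S | (∀ k, S k ⊆ Y ∧ (S k).card = t) ∧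
    (∀ k k', k ≠ k' → Disjoint (S k) (S k')) ∧
    (∀ (I : Finset (Fin ℓ)) (j : Fin (r - 3)),
      ∀ x ∈ S (Sum.inl I), ∀ y ∈ S (Sum.inr j), G.Adj x y) ∧
    (∀ j j' : Fin (r - 3), j ≠ j' →
      ∀ x ∈ S (Sum.inr j), ∀ y ∈ S (Sum.inr j'), G.Adj x y)}

/-- `(x, y) →ᵢ S` for an ordered pair of vertices. -/
def PairArrow {V : Type*} (G : SimpleGraph V) {r ℓ : ℕ} (S : Family V r ℓ) (i : Fin ℓ)
    (x y : V) : Prop :=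
  (∀ j : Fin (r - 3), ∀ v ∈ S (Sum.inr j), G.Adj x v ∧ G.Adj y v) ∧
  (∀ I : Finset (Fin ℓ), i ∈ I → ∀ v ∈ S (Sum.inl I), G.Adj x v) ∧
  (∀ I : Finset (Fin ℓ), i ∉ I → ∀ v ∈ S (Sum.inl I), G.Adj y v)

/-- `e →ᵢ S` for an unordered pair `e = xy`: one of the two orderings satisfies `→ᵢ`. -/
def EdgeArrow {V : Type*} (G : SimpleGraph V) {r ℓ : ℕ} (S : Family V r ℓ) (i : Fin ℓ)
    (e : Sym2 V) : Prop :=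
  ∃ x y : V, e = s(x, y) ∧ PairArrow G S i x y

/-- `(e₁, …, e_ℓ) → S`, i.e. `eᵢ →ᵢ S` for every `i`. -/
def TupleArrow {V : Type*} (G : SimpleGraph V) {r ℓ : ℕ} (S : Family V r ℓ)
    (e : Fin ℓ → Sym2 V) : Prop :=
  ∀ i, EdgeArrow G S i (e i)

/-- `V(D)`, the set of endpoints of the members of `D`. -/
def endpoints {V : Type*} [Fintype V] [DecidableEq V] (D : Finset (Sym2 V)) : Finset V :=
  Finset.univ.filter fun v => ∃ e ∈ D, v ∈ e

/-- The average degree `2 |D| / |V(D)|` of the graph with vertex set `V(D)` and edge set `D`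
(`0` if `D` is empty). -/
noncomputable def avgDegree {V : Type*} [Fintype V] [DecidableEq V] (D : Finset (Sym2 V)) : ℝ :=
  2 * (D.card : ℝ) / ((endpoints D).card : ℝ)

/-- `S` is `(r, ℓ, t, C, α)`-good for `(X, Y)`: it is proper, and there are sets `E₁, …, E_ℓ` of
edges of `G` with both ends in `X`, each of average degree at least `2^{-ℓ} α C`, such that
`(e₁, …, e_ℓ) → S` for all `e₁ ∈ E₁, …, e_ℓ ∈ E_ℓ`. -/
def IsGood {V : Type*} [Fintype V] [DecidableEq V] (G : SimpleGraph V)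
    (r ℓ t C : ℕ) (α : ℝ) (X Y : Finset V) (S : Family V r ℓ) : Prop :=
  S ∈ properFamilies G r ℓ t Y ∧
  ∃ E : Fin ℓ → Finset (Sym2 V),
    (∀ j, ∀ e ∈ E j, e ∈ G.edgeSet ∧ ∀ v ∈ e, v ∈ X) ∧
    (∀ j, ((2 : ℝ) ^ ℓ)⁻¹ * α * (C : ℝ) ≤ avgDegree (E j)) ∧
    ∀ e : Fin ℓ → Sym2 V, (∀ j, e j ∈ E j) → TupleArrow G S e

/-- `(X, Y)` is `(C, α)`-dense in copies of `Z_ℓ^{r,t}`: at least `2^{-ℓ} α |Y|^s` proper functions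
are good for `(X, Y)`, where `s = (2^ℓ + r - 3) t`. -/
def IsDense {V : Type*} [Fintype V] [DecidableEq V] (G : SimpleGraph V)
    (r ℓ t C : ℕ) (α : ℝ) (X Y : Finset V) : Prop :=
  ((2 : ℝ) ^ ℓ)⁻¹ * α * (Y.card : ℝ) ^ ((2 ^ ℓ + (r - 3)) * t) ≤
    ({S : Family V r ℓ | S ∈ properFamilies G r ℓ t Y ∧ IsGood G r ℓ t C α X Y S}.ncard : ℝ)

end Zykov

/-!
Write `n = |Y| = |Z_j|` and consider a uniformly random choice `z` of `t` vertices from each `Z_j`.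
Such a choice is useful for an edge `e` inside `X` if the chosen vertices are distinct, span all
edges between different `Z_j`, and are adjacent to both ends of `e`. The ends of `e` have at least
`2γn` common neighbours in every `Z_j`, so by the counting lemma applied inside these common
neighbourhoods (`abs_card_filter_sub_le`) this has probability at least about `θ`, where `θ > 0`
depends only on `r, t, d, γ`.

Take a good family `S` for `r = 3`, with edge sets `E_1, …, E_ℓ*`, and cut its sets `S_I`, which have
`t* = m t` elements, into `m` blocks of size `t`; the `k`-th blocks of all the `S_I` together form
the block `k`. By regularity almost all tuples of vertices in `Y` are typical: each subset of the
tuple has a common neighbourhood of about the expected size in every `Z_j`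
(`card_filter_not_isTypical_le`). As a positive proportion of all tuples come from good families,
some good family is typical (`exists_isTypical_isGood`). For this one, the events that `z` is
completely joined to block `k` have probability bounded below and are almost pairwise independent,
so the second moment method shows that, for `m` large, `z` fails to be joined to any block with
probability at most `θ / 4` (`IsTypical.card_unjoined_le`). Hence for every edge `e` in any `E_j`
the choice `z` is useful and joined to some block with probability at least `θ / 4`
(`le_card_filter_of_common_nbhd`).

By averaging (`exists_heavy_point`) some `z` that is joined to a block `k` is useful for at least a
`θ / 8` proportion of `E_j`, for at least `θ ℓ* / 8 ≥ ℓ` of the indices `j`. Restricting block `k` to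
these indices and taking the vertices of `z` as the sets `S'_j` gives the required family
(`exists_isGood_of_selection`). The loss of a factor `θ / 8` in the average degree is
made up for by the choice of `C*`. Here `θ` determines `ℓ*`, then `m`, and only `ε` and `C*` depend
on `α` and `C`.
-/

namespace Zykov

/-! ### Sums over products of finite sets -/

/-- Averaging over a product of finite sets is unchanged if one coordinate is resampled. This is
what allows all coordinates but one or two to be frozen in the counting arguments below. -/
theorem card_nsmul_sum_piFinset {ι V M : Type*} [Fintype ι] [DecidableEq ι] [AddCommMonoid M]
    (A : ι → Finset V) (u : ι) (F : (ι → V) → M) :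
    (A u).card • ∑ z ∈ Fintype.piFinset A, F z =
      ∑ z ∈ Fintype.piFinset A, ∑ a ∈ A u, F (Function.update z u a) := by
  have h : (A u).card • ∑ z ∈ Fintype.piFinset A, F z =
      ∑ z ∈ Fintype.piFinset A, ∑ _a ∈ A u, F z := by
    simp [Finset.smul_sum]
  rw [h, ← Finset.sum_product', ← Finset.sum_product']
  refine Finset.sum_nbij' (fun q => (Function.update q.1 u q.2, q.1 u))
    (fun q => (Function.update q.1 u q.2, q.1 u)) ?_ ?_ ?_ ?_ ?_
  · rintro ⟨z, a⟩ hq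
    simp only [Finset.mem_product, Fintype.mem_piFinset] at hq ⊢
    refine ⟨fun w => ?_, hq.1 u⟩
    rcases eq_or_ne w u with rfl | hw
    · simpa using hq.2
    · simpa [hw] using hq.1 w
  · rintro ⟨z, a⟩ hq
    simp only [Finset.mem_product, Fintype.mem_piFinset] at hq ⊢
    refine ⟨fun w => ?_, hq.1 u⟩
    rcases eq_or_ne w u with rfl | hw
    · simpa using hq.2
    · simpa [hw] using hq.1 w
  · rintro ⟨z, a⟩ _
    simp only [Function.update_self, Function.update_idem, Function.update_eq_self]
  · rintro ⟨z, a⟩ _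
    simp only [Function.update_self, Function.update_idem, Function.update_eq_self]
  · rintro ⟨z, a⟩ _
    change F z = F (Function.update (Function.update z u a) u (z u))
    rw [Function.update_idem, Function.update_eq_self]

theorem card_mul_card_filter_piFinset {ι V : Type*} [Fintype ι] [DecidableEq ι]
    (A : ι → Finset V) (u : ι) (P : (ι → V) → Prop) [DecidablePred P] :
    (A u).card * ((Fintype.piFinset A).filter P).card =
      ∑ z ∈ Fintype.piFinset A, ((A u).filter fun a => P (Function.update z u a)).card := by
  have h := card_nsmul_sum_piFinset A u (fun z => if P z then 1 else 0)
  rw [smul_eq_mul] at h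
  simp only [Finset.card_filter]
  exact h

/-- At most a `|ι|² / n` proportion of the points of a product of `n`-sets have a repeated
coordinate. -/
theorem card_filter_not_injective_le {ι V : Type*} [Fintype ι] [DecidableEq ι] [DecidableEq V]
    (Z : ι → Finset V) {n : ℕ} (hZ : ∀ u, (Z u).card = n) :
    n * ((Fintype.piFinset Z).filter fun z => ¬ Function.Injective z).card ≤
      Fintype.card ι ^ 2 * n ^ Fintype.card ι := by
  have hpi : (Fintype.piFinset Z).card = n ^ Fintype.card ι := by
    simp [Fintype.card_piFinset, hZ]
  have hsub : ((Fintype.piFinset Z).filter fun z => ¬ Function.Injective z) ⊆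
      (Finset.univ : Finset ι).offDiag.biUnion fun q =>
        (Fintype.piFinset Z).filter fun z => z q.1 = z q.2 := by
    intro z hz
    obtain ⟨hz, hne⟩ := Finset.mem_filter.1 hz
    simp only [Function.Injective] at hne
    push Not at hne
    obtain ⟨u, v, huv, hne⟩ := hne
    simp only [Finset.mem_biUnion, Finset.mem_offDiag, Finset.mem_filter, Finset.mem_univ,
      true_and]
    exact ⟨(u, v), hne, hz, huv⟩
  have hone : ∀ q ∈ (Finset.univ : Finset ι).offDiag,
      n * ((Fintype.piFinset Z).filter fun z => z q.1 = z q.2).card ≤ n ^ Fintype.card ι := by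
    intro q hq
    have hne : q.1 ≠ q.2 := by simpa using hq
    rw [← hZ q.1, card_mul_card_filter_piFinset Z q.1, hZ, ← hpi, Finset.card_eq_sum_ones]
    refine Finset.sum_le_sum fun z _ => Finset.card_le_one.2 fun a ha b hb => ?_
    simp only [Finset.mem_filter, Function.update_self, Function.update_of_ne hne.symm] at ha hb
    rw [ha.2, hb.2]
  calc _ ≤ n * ∑ q ∈ (Finset.univ : Finset ι).offDiag,
        ((Fintype.piFinset Z).filter fun z => z q.1 = z q.2).card :=
        Nat.mul_le_mul_left _ ((Finset.card_le_card hsub).trans Finset.card_biUnion_le)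
    _ ≤ ∑ q ∈ (Finset.univ : Finset ι).offDiag, n ^ Fintype.card ι := by
        rw [Finset.mul_sum]; exact Finset.sum_le_sum hone
    _ ≤ _ := by
        rw [Finset.sum_const, smul_eq_mul]
        refine Nat.mul_le_mul_right _ ?_
        rw [Finset.offDiag_card, sq, Finset.card_univ]
        exact Nat.sub_le _ _

/-! ### Regularity as a cut-norm bound -/

/-- The edges between `A` and `B` deviate from density `δ` by at most `c` in cut norm: every
rectangle `A' × B'` contains `δ |A'| |B'| ± c` of them. -/
def HasCutBound {V : Type*} (G : SimpleGraph V) [DecidableRel G.Adj] (A B : Finset V)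
    (δ c : ℝ) : Prop :=
  ∀ A' ⊆ A, ∀ B' ⊆ B, |((G.interedges A' B').card : ℝ) - δ * A'.card * B'.card| ≤ c

theorem interedges_card_eq {V : Type*} (G : SimpleGraph V) [DecidableRel G.Adj]
    (A B : Finset V) :
    ((G.interedges A B).card : ℝ) = (G.edgeDensity A B : ℝ) * A.card * B.card := by
  rw [SimpleGraph.edgeDensity_def]
  push_cast
  rcases A.eq_empty_or_nonempty with rfl | hA
  · simp [SimpleGraph.interedges, Rel.interedges]
  rcases B.eq_empty_or_nonempty with rfl | hB
  · simp [SimpleGraph.interedges, Rel.interedges]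
  have h1 : (A.card : ℝ) ≠ 0 := by exact_mod_cast hA.card_pos.ne'
  have h2 : (B.card : ℝ) ≠ 0 := by exact_mod_cast hB.card_pos.ne'
  field_simp

/-- A rectangle with a side shorter than `ε` times the full side, to which regularity does not
apply, is itself smaller than the permitted error. -/
theorem hasCutBound_of_isUniform {V : Type*} {G : SimpleGraph V} [DecidableRel G.Adj] {ε : ℝ}
    {A B : Finset V} (h : G.IsUniform ε A B) (hε : 0 < ε) :
    HasCutBound G A B (G.edgeDensity A B) (ε * A.card * B.card) := by
  intro A' hA B' hB
  have cA : (A'.card : ℝ) ≤ A.card := by exact_mod_cast Finset.card_le_card hA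
  have cB : (B'.card : ℝ) ≤ B.card := by exact_mod_cast Finset.card_le_card hB
  have key : |(G.edgeDensity A' B' : ℝ) - G.edgeDensity A B| * (A'.card * B'.card) ≤
      ε * A.card * B.card := by
    have hle : |(G.edgeDensity A' B' : ℝ) - G.edgeDensity A B| ≤ 1 := by
      have h1 : (0 : ℝ) ≤ G.edgeDensity A' B' := by exact_mod_cast G.edgeDensity_nonneg _ _
      have h2 : (G.edgeDensity A' B' : ℝ) ≤ 1 := by exact_mod_cast G.edgeDensity_le_one _ _
      have h3 : (0 : ℝ) ≤ G.edgeDensity A B := by exact_mod_cast G.edgeDensity_nonneg _ _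
      have h4 : (G.edgeDensity A B : ℝ) ≤ 1 := by exact_mod_cast G.edgeDensity_le_one _ _
      rw [abs_le]; constructor <;> linarith
    by_cases h1 : (A.card : ℝ) * ε ≤ A'.card
    · by_cases h2 : (B.card : ℝ) * ε ≤ B'.card
      · calc _ ≤ ε * (A'.card * B'.card) := by
              gcongr; exact (h hA hB h1 h2).le
          _ ≤ ε * (A.card * B.card) := by gcongr
          _ = _ := by ring
      · push Not at h2
        calc _ ≤ 1 * ((A'.card : ℝ) * B'.card) := by gcongr
          _ ≤ 1 * ((A.card : ℝ) * (B.card * ε)) := by gcongr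
          _ = _ := by ring
    · push Not at h1
      calc _ ≤ 1 * ((A'.card : ℝ) * B'.card) := by gcongr
        _ ≤ 1 * (((A.card : ℝ) * ε) * B.card) := by gcongr
        _ = _ := by ring
  rw [interedges_card_eq]
  calc _ = |(G.edgeDensity A' B' : ℝ) - G.edgeDensity A B| * (A'.card * B'.card) := by
        have h0 : (0 : ℝ) ≤ A'.card * B'.card := by positivity
        rw [mul_assoc, mul_assoc, ← sub_mul, abs_mul, abs_of_nonneg h0]
    _ ≤ _ := key

/-! ### The counting lemma -/

theorem ite_and_sub_mul_ite (p q : Prop) [Decidable p] [Decidable q] (d : ℝ) :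
    (if p ∧ q then (1 : ℝ) else 0) - d * (if p then 1 else 0) =
      if p then (if q then 1 else 0) - d else 0 := by
  by_cases hp : p <;> by_cases hq : q <;> simp [hp, hq]

/-- The counting lemma, restricted to boxes: among the points of the product of the sets `Z u`, the
number of those with `z u ∈ W u` for all `u` and with `z u` adjacent to `z v` for all `(u, v) ∈ H`
is what it would be in a random graph with densities `δ u v`, up to `|H| ε n^|ι|`. Each pair in `H`
is replaced by its density in turn, at the cost of one cut-norm error. -/
theorem abs_card_filter_sub_le {ι V : Type*} [Fintype ι] [DecidableEq ι] [DecidableEq V]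
    (G : SimpleGraph V) [DecidableRel G.Adj] (Z W : ι → Finset V) {n : ℕ} (hn : 0 < n)
    (hZ : ∀ u, (Z u).card = n) (hW : ∀ u, W u ⊆ Z u) (δ : ι → ι → ℝ) {ε : ℝ}
    (H : Finset (ι × ι)) (hirr : ∀ u v, (u, v) ∈ H → u ≠ v ∧ (v, u) ∉ H)
    (hδ : ∀ u v, (u, v) ∈ H → 0 ≤ δ u v ∧ δ u v ≤ 1)
    (hcut : ∀ u v, (u, v) ∈ H → HasCutBound G (Z u) (Z v) (δ u v) (ε * n ^ 2)) :
    |(((Fintype.piFinset Z).filter fun z =>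
        (∀ u, z u ∈ W u) ∧ ∀ q ∈ H, G.Adj (z q.1) (z q.2)).card : ℝ) -
      (∏ q ∈ H, δ q.1 q.2) * ∏ u, ((W u).card : ℝ)| ≤
      H.card * ε * n ^ Fintype.card ι := by
  induction H using Finset.induction_on with
  | empty =>
    have : ((Fintype.piFinset Z).filter fun z => ∀ u, z u ∈ W u) = Fintype.piFinset W := by
      ext z
      simp only [Finset.mem_filter, Fintype.mem_piFinset]
      exact ⟨fun h => h.2, fun h => ⟨fun u => hW u (h u), h⟩⟩
    simp [this, Fintype.card_piFinset]
  | insert q H hq ih =>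
    obtain ⟨u, v⟩ := q
    have ih' := ih (fun a b h => ⟨(hirr a b (Finset.mem_insert_of_mem h)).1,
      fun h' => (hirr a b (Finset.mem_insert_of_mem h)).2 (Finset.mem_insert_of_mem h')⟩)
      (fun a b h => hδ a b (Finset.mem_insert_of_mem h))
      (fun a b h => hcut a b (Finset.mem_insert_of_mem h))
    obtain ⟨huv, hvu⟩ := hirr u v (Finset.mem_insert_self _ _)
    have hvu' : (v, u) ∉ H := fun h => hvu (Finset.mem_insert_of_mem h)
    obtain ⟨hd0, hd1⟩ := hδ u v (Finset.mem_insert_self _ _)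
    have hc := hcut u v (Finset.mem_insert_self _ _)
    have hpi : ((Fintype.piFinset Z).card : ℝ) = n ^ Fintype.card ι := by
      simp [Fintype.card_piFinset, hZ]
    set P : (ι → V) → Prop := fun z =>
      (∀ u, z u ∈ W u) ∧ ∀ q ∈ H, G.Adj (z q.1) (z q.2) with hP
    let hdec : DecidablePred P := fun z =>
      inferInstanceAs (Decidable ((∀ u, z u ∈ W u) ∧ ∀ q ∈ H, G.Adj (z q.1) (z q.2)))
    set F : (ι → V) → ℝ := fun z =>
      if P z then (if G.Adj (z u) (z v) then 1 else 0) - δ u v else 0 with hF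
    have hdiff : (((Fintype.piFinset Z).filter fun z =>
        (∀ u, z u ∈ W u) ∧ ∀ q ∈ insert (u, v) H, G.Adj (z q.1) (z q.2)).card : ℝ) -
        δ u v * ((Fintype.piFinset Z).filter P).card = ∑ z ∈ Fintype.piFinset Z, F z := by
      rw [Finset.card_filter, Finset.card_filter]
      push_cast
      rw [Finset.mul_sum, ← Finset.sum_sub_distrib]
      refine Finset.sum_congr rfl fun z _ => ?_
      have e : ((∀ u, z u ∈ W u) ∧ ∀ q ∈ insert (u, v) H, G.Adj (z q.1) (z q.2)) ↔
          P z ∧ G.Adj (z u) (z v) := by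
        rw [Finset.forall_mem_insert, and_left_comm, and_comm]
      rw [if_congr e rfl rfl]
      change (if P z ∧ G.Adj (z u) (z v) then (1 : ℝ) else 0) -
        δ u v * (if P z then 1 else 0) =
          if P z then (if G.Adj (z u) (z v) then 1 else 0) - δ u v else 0
      exact ite_and_sub_mul_ite _ _ _
    -- With all coordinates but `u` and `v` fixed, `P` is a condition on each of these two
    -- coordinates separately, so the cut bound applies to the remaining double sum.
    have hinner : ∀ z ∈ Fintype.piFinset Z,
        |∑ a ∈ Z u, ∑ b ∈ Z v, F (Function.update (Function.update z u a) v b)| ≤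
          ε * n ^ 2 := by
      intro z _
      let R₁ : V → Prop := fun a => (∀ w, w ≠ v → Function.update z u a w ∈ W w) ∧
        ∀ q ∈ H, q.1 ≠ v → q.2 ≠ v →
          G.Adj (Function.update z u a q.1) (Function.update z u a q.2)
      let R₂ : V → Prop := fun b => (∀ w, w ≠ u → Function.update z v b w ∈ W w) ∧
        ∀ q ∈ H, q.1 ≠ u → q.2 ≠ u →
          G.Adj (Function.update z v b q.1) (Function.update z v b q.2)
      classical
      have hR : ∀ a b, P (Function.update (Function.update z u a) v b) ↔ R₁ a ∧ R₂ b := by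
        intro a b
        have e1 : ∀ w, w ≠ v → Function.update (Function.update z u a) v b w =
            Function.update z u a w := fun w hw => Function.update_of_ne hw _ _
        have e2 : ∀ w, w ≠ u → Function.update (Function.update z u a) v b w =
            Function.update z v b w := fun w hw => by
          rw [Function.update_comm huv, Function.update_of_ne hw]
        constructor
        · rintro ⟨h1, h2⟩
          refine ⟨⟨fun w hw => e1 w hw ▸ h1 w, fun q hq h3 h4 => ?_⟩,
            ⟨fun w hw => e2 w hw ▸ h1 w, fun q hq h3 h4 => ?_⟩⟩
          · have := h2 q hq
            rwa [e1 _ h3, e1 _ h4] at this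
          · have := h2 q hq
            rwa [e2 _ h3, e2 _ h4] at this
        · rintro ⟨⟨h1, h2⟩, ⟨h3, h4⟩⟩
          refine ⟨fun w => ?_, fun q hqH => ?_⟩
          · by_cases hw : w = v
            · have hw' : w ≠ u := fun h => huv (h.symm.trans hw)
              rw [e2 w hw']; exact h3 w hw'
            · rw [e1 w hw]; exact h1 w hw
          · by_cases h5 : q.1 ≠ v ∧ q.2 ≠ v
            · rw [e1 _ h5.1, e1 _ h5.2]; exact h2 q hqH h5.1 h5.2
            · have h6 : q.1 ≠ u ∧ q.2 ≠ u := by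
                obtain ⟨a, b⟩ := q
                simp only at h5 ⊢
                constructor
                · rintro rfl
                  have : b = v := by tauto
                  subst this; exact hq hqH
                · rintro rfl
                  have : a = v := by tauto
                  subst this; exact hvu' hqH
              rw [e2 _ h6.1, e2 _ h6.2]; exact h4 q hqH h6.1 h6.2
      have hval : ∑ a ∈ Z u, ∑ b ∈ Z v, F (Function.update (Function.update z u a) v b) =
          ((G.interedges ((Z u).filter R₁) ((Z v).filter R₂)).card : ℝ) -
            δ u v * ((Z u).filter R₁).card * ((Z v).filter R₂).card := by
        have h1 : ∀ a b, F (Function.update (Function.update z u a) v b) =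
            if R₁ a then (if R₂ b then (if G.Adj a b then 1 else 0) - δ u v else 0) else 0 := by
          intro a b
          simp only [hF, hR, Function.update_self, Function.update_of_ne huv]
          by_cases h1 : R₁ a <;> by_cases h2 : R₂ b <;> simp [h1, h2]
        simp only [h1]
        have h2 : ((G.interedges ((Z u).filter R₁) ((Z v).filter R₂)).card : ℝ) =
            ∑ a ∈ (Z u).filter R₁, ∑ b ∈ (Z v).filter R₂, if G.Adj a b then (1 : ℝ) else 0 := by
          rw [SimpleGraph.interedges_def, Finset.card_filter, Finset.sum_product]
          push_cast
          rfl
        rw [h2]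
        have h3 : δ u v * ((Z u).filter R₁).card * ((Z v).filter R₂).card =
            ∑ a ∈ (Z u).filter R₁, ∑ b ∈ (Z v).filter R₂, δ u v := by
          simp; ring
        rw [h3, ← Finset.sum_sub_distrib, Finset.sum_filter]
        refine Finset.sum_congr rfl fun a _ => ?_
        split_ifs with h
        · rw [← Finset.sum_sub_distrib, Finset.sum_filter]
        · simp
      rw [hval]
      exact hc _ (Finset.filter_subset _ _) _ (Finset.filter_subset _ _)
    have hsum : |∑ z ∈ Fintype.piFinset Z, F z| ≤ ε * n ^ Fintype.card ι := by
      have h1 := card_nsmul_sum_piFinset Z v F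
      have h2 := card_nsmul_sum_piFinset Z u
        (fun z => ∑ b ∈ Z v, F (Function.update z v b))
      rw [← h1, hZ, hZ] at h2
      simp only [nsmul_eq_mul] at h2
      have hn' : (0 : ℝ) < (n : ℝ) ^ 2 := by positivity
      have h3 : (n : ℝ) ^ 2 * |∑ z ∈ Fintype.piFinset Z, F z| ≤
          n ^ 2 * (ε * n ^ Fintype.card ι) := by
        calc _ = |(n : ℝ) * (n * ∑ z ∈ Fintype.piFinset Z, F z)| := by
              rw [← mul_assoc, abs_mul, ← sq, abs_of_pos hn']
          _ ≤ ∑ z ∈ Fintype.piFinset Z, ε * n ^ 2 := by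
              rw [h2]
              exact (Finset.abs_sum_le_sum_abs _ _).trans (Finset.sum_le_sum hinner)
          _ = _ := by rw [Finset.sum_const, nsmul_eq_mul, hpi]; ring
      exact le_of_mul_le_mul_left h3 hn'
    rw [Finset.prod_insert hq, Finset.card_insert_of_notMem hq]
    set N : ℝ := (((Fintype.piFinset Z).filter P).card : ℝ)
    calc _ = |(∑ z ∈ Fintype.piFinset Z, F z) +
          δ u v * (N - (∏ q ∈ H, δ q.1 q.2) * ∏ u, ((W u).card : ℝ))| := by
          rw [← hdiff]; congr 1; ring
      _ ≤ ε * n ^ Fintype.card ι + 1 * (H.card * ε * n ^ Fintype.card ι) := by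
          refine (abs_add_le _ _).trans (add_le_add hsum ?_)
          rw [abs_mul, abs_of_nonneg hd0]
          exact mul_le_mul hd1 ih' (abs_nonneg _) zero_le_one
      _ = _ := by push_cast; ring

/-! ### Typical tuples -/

/-- The vertices of `W` adjacent to `y b` for every `b ∈ B`. -/
def commonNbhd {V σ : Type*} (G : SimpleGraph V) [DecidableRel G.Adj] (W : Finset V) (y : σ → V)
    (B : Finset σ) : Finset V :=
  W.filter fun v => ∀ b ∈ B, G.Adj (y b) v

theorem mem_commonNbhd {V σ : Type*} {G : SimpleGraph V} [DecidableRel G.Adj] {W : Finset V}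
    {y : σ → V} {B : Finset σ} {v : V} :
    v ∈ commonNbhd G W y B ↔ v ∈ W ∧ ∀ b ∈ B, G.Adj (y b) v :=
  Finset.mem_filter

theorem commonNbhd_subset {V σ : Type*} (G : SimpleGraph V) [DecidableRel G.Adj] (W : Finset V)
    (y : σ → V) (B : Finset σ) : commonNbhd G W y B ⊆ W :=
  Finset.filter_subset _ _

/-- Few vertices of `Y` have a degree into `W` that deviates from `δ |W|` by more than `τ`: those
with too large a degree span a rectangle with `W`, and so do those with too small a degree. -/
theorem card_filter_deviation_le {V : Type*} {G : SimpleGraph V} [DecidableRel G.Adj]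
    {Y Z : Finset V} {δ c : ℝ} (h : HasCutBound G Y Z δ c) {W : Finset V} (hW : W ⊆ Z) (τ : ℝ) :
    ((Y.filter fun y => τ < |((W.filter (G.Adj y)).card : ℝ) - δ * W.card|).card : ℝ) * τ ≤
      2 * c := by
  classical
  set f : V → ℝ := fun y => ((W.filter (G.Adj y)).card : ℝ) - δ * W.card with hf
  have hsum : ∀ T : Finset V, ∑ y ∈ T, f y =
      ((G.interedges T W).card : ℝ) - δ * T.card * W.card := by
    intro T
    have : ((G.interedges T W).card : ℝ) = ∑ y ∈ T, ((W.filter (G.Adj y)).card : ℝ) := by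
      rw [SimpleGraph.interedges_def, Finset.card_filter, Finset.sum_product]
      simp only [Finset.card_filter]
      push_cast
      rfl
    rw [this, hf, Finset.sum_sub_distrib, Finset.sum_const, nsmul_eq_mul]
    ring
  have hpos : ((Y.filter fun y => τ < f y).card : ℝ) * τ ≤ c := by
    have h1 : ((Y.filter fun y => τ < f y).card : ℝ) * τ ≤ ∑ y ∈ Y.filter fun y => τ < f y, f y := by
      rw [← nsmul_eq_mul]
      exact Finset.card_nsmul_le_sum _ _ _ fun y hy => (Finset.mem_filter.1 hy).2.le
    rw [hsum] at h1
    exact h1.trans ((le_abs_self _).trans (h _ (Finset.filter_subset _ _) _ hW))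
  have hneg : ((Y.filter fun y => τ < - f y).card : ℝ) * τ ≤ c := by
    have h1 : ((Y.filter fun y => τ < - f y).card : ℝ) * τ ≤
        ∑ y ∈ Y.filter fun y => τ < - f y, - f y := by
      rw [← nsmul_eq_mul]
      exact Finset.card_nsmul_le_sum _ _ _ fun y hy => (Finset.mem_filter.1 hy).2.le
    rw [Finset.sum_neg_distrib, hsum] at h1
    exact h1.trans ((neg_le_abs _).trans (h _ (Finset.filter_subset _ _) _ hW))
  have hsplit : (Y.filter fun y => τ < |f y|) =
      (Y.filter fun y => τ < f y) ∪ Y.filter fun y => τ < - f y := by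
    rw [← Finset.filter_or]
    simp only [lt_abs]
  have hcard : ((Y.filter fun y => τ < |f y|).card : ℝ) ≤
      (Y.filter fun y => τ < f y).card + (Y.filter fun y => τ < - f y).card := by
    rw [hsplit]; exact_mod_cast Finset.card_union_le _ _
  have hc : 0 ≤ c := (abs_nonneg _).trans (h ∅ (Finset.empty_subset _) ∅ (Finset.empty_subset _))
  rcases le_total τ 0 with hτ | hτ
  · exact (mul_nonpos_of_nonneg_of_nonpos (Nat.cast_nonneg _) hτ).trans (by linarith)
  · calc _ ≤ (((Y.filter fun y => τ < f y).card : ℝ) +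
          (Y.filter fun y => τ < - f y).card) * τ := mul_le_mul_of_nonneg_right hcard hτ
      _ ≤ _ := by linarith

/-- A tuple `y` is typical if adding any one of its vertices to any set of others
multiplies the size of the common neighbourhood in each `Z u` by the density `δ u`, up to an
additive error `τ`. -/
def IsTypical {V σ ι : Type*} [DecidableEq σ] (G : SimpleGraph V) [DecidableRel G.Adj]
    (Z : ι → Finset V) (δ : ι → ℝ) (τ : ℝ) (y : σ → V) : Prop :=
  ∀ u (B : Finset σ) b, b ∉ B →
    |((commonNbhd G (Z u) y (insert b B)).card : ℝ) - δ u * (commonNbhd G (Z u) y B).card| ≤ τ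

open Classical in
/-- Almost all tuples in `Y` are typical. For a fixed set `B` and a further index `b`, the entry
`y b` has to avoid the few vertices of exceptional degree into the common neighbourhood of the
entries in `B`, which does not depend on `y b`. -/
theorem card_filter_not_isTypical_le {V σ ι : Type*} [Fintype σ] [DecidableEq σ]
    [Fintype ι] {G : SimpleGraph V} [DecidableRel G.Adj] {Y : Finset V} {Z : ι → Finset V}
    {δ : ι → ℝ} {c τ : ℝ} (hτ : 0 ≤ τ) (h : ∀ u, HasCutBound G Y (Z u) (δ u) c) :
    (Y.card : ℝ) * ((Fintype.piFinset fun _ : σ => Y).filter fun y =>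
        ¬ IsTypical G Z δ τ y).card * τ ≤
      Fintype.card ι * 2 ^ Fintype.card σ * Fintype.card σ * (2 * c) *
        (Y.card : ℝ) ^ Fintype.card σ := by
  set D : ι × Finset σ × σ → (σ → V) → Prop := fun k y =>
    k.2.2 ∉ k.2.1 ∧ τ < |((commonNbhd G (Z k.1) y (insert k.2.2 k.2.1)).card : ℝ) -
      δ k.1 * (commonNbhd G (Z k.1) y k.2.1).card| with hD
  set Ω : Finset (σ → V) := Fintype.piFinset fun _ : σ => Y with hΩ
  have hΩc : (Ω.card : ℝ) = (Y.card : ℝ) ^ Fintype.card σ := by simp [hΩ]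
  have hsub : (Ω.filter fun y => ¬ IsTypical G Z δ τ y) ⊆
      (Finset.univ : Finset (ι × Finset σ × σ)).biUnion fun k => Ω.filter (D k) := by
    intro y hy
    obtain ⟨hy, hn⟩ := Finset.mem_filter.1 hy
    simp only [IsTypical] at hn
    push Not at hn
    obtain ⟨u, B, b, hb, hlt⟩ := hn
    exact Finset.mem_biUnion.2 ⟨(u, B, b), Finset.mem_univ _, Finset.mem_filter.2 ⟨hy, hb, hlt⟩⟩
  have hone : ∀ k, (Y.card : ℝ) * (Ω.filter (D k)).card * τ ≤
      (2 * c) * (Y.card : ℝ) ^ Fintype.card σ := by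
    rintro ⟨u, B, b⟩
    have h1 : (Y.card : ℝ) * (Ω.filter (D (u, B, b))).card =
        ∑ y ∈ Ω, ((Y.filter fun a => D (u, B, b) (Function.update y b a)).card : ℝ) := by
      exact_mod_cast card_mul_card_filter_piFinset (fun _ : σ => Y) b (D (u, B, b))
    rw [h1, Finset.sum_mul, ← hΩc, mul_comm, ← nsmul_eq_mul]
    refine Finset.sum_le_card_nsmul _ _ _ fun y _ => ?_
    refine le_trans ?_ (card_filter_deviation_le (h u) (commonNbhd_subset G (Z u) y B) τ)
    refine mul_le_mul_of_nonneg_right ?_ hτ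
    refine Nat.cast_le.2 (Finset.card_le_card fun a ha => ?_)
    obtain ⟨ha, hb, hlt⟩ := Finset.mem_filter.1 ha
    refine Finset.mem_filter.2 ⟨ha, ?_⟩
    simp only at hb hlt
    have hne : ∀ b' ∈ B, b' ≠ b := fun b' hb' h => hb (h ▸ hb')
    have e1 : commonNbhd G (Z u) (Function.update y b a) B = commonNbhd G (Z u) y B := by
      ext v
      simp only [mem_commonNbhd]
      refine and_congr_right fun _ => forall₂_congr fun b' hb' => ?_
      rw [Function.update_of_ne (hne b' hb')]
    have e2 : commonNbhd G (Z u) (Function.update y b a) (insert b B) =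
        (commonNbhd G (Z u) y B).filter (G.Adj a) := by
      ext v
      rw [Finset.mem_filter, ← e1, mem_commonNbhd, mem_commonNbhd, Finset.forall_mem_insert,
        Function.update_self]
      tauto
    rwa [e1, e2] at hlt
  calc _ ≤ (Y.card : ℝ) * (∑ k : ι × Finset σ × σ, ((Ω.filter (D k)).card : ℝ)) * τ := by
        gcongr
        exact_mod_cast (Finset.card_le_card hsub).trans Finset.card_biUnion_le
    _ = ∑ k : ι × Finset σ × σ, (Y.card : ℝ) * (Ω.filter (D k)).card * τ := by
        rw [Finset.mul_sum, Finset.sum_mul]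
    _ ≤ ∑ _k : ι × Finset σ × σ, (2 * c) * (Y.card : ℝ) ^ Fintype.card σ :=
        Finset.sum_le_sum fun k _ => hone k
    _ = _ := by
        rw [Finset.sum_const, Finset.card_univ, nsmul_eq_mul]
        simp only [Fintype.card_prod, Fintype.card_finset]
        push_cast
        ring

theorem IsTypical.abs_card_commonNbhd_sub_le {V σ ι : Type*} [DecidableEq σ] {G : SimpleGraph V}
    [DecidableRel G.Adj] {Z : ι → Finset V} {δ : ι → ℝ} {τ : ℝ} {y : σ → V}
    (h : IsTypical G Z δ τ y) (u : ι) (h0 : 0 ≤ δ u) (h1 : δ u ≤ 1) (B : Finset σ) :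
    |((commonNbhd G (Z u) y B).card : ℝ) - δ u ^ B.card * (Z u).card| ≤ B.card * τ := by
  induction B using Finset.induction_on with
  | empty => simp [commonNbhd]
  | insert b B hb ih =>
    rw [Finset.card_insert_of_notMem hb]
    set N : ℝ := ((commonNbhd G (Z u) y B).card : ℝ)
    calc _ = |(((commonNbhd G (Z u) y (insert b B)).card : ℝ) - δ u * N) +
          δ u * (N - δ u ^ B.card * (Z u).card)| := by congr 1; ring
      _ ≤ τ + 1 * (B.card * τ) := by
          refine (abs_add_le _ _).trans (add_le_add (h u B b hb) ?_)
          rw [abs_mul, abs_of_nonneg h0]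
          exact mul_le_mul h1 ih (abs_nonneg _) zero_le_one
      _ = _ := by push_cast; ring

theorem abs_prod_sub_prod_le {ι : Type*} (s : Finset ι) (a b : ι → ℝ)
    (ha : ∀ i ∈ s, 0 ≤ a i ∧ a i ≤ 1) (hb : ∀ i ∈ s, 0 ≤ b i ∧ b i ≤ 1) :
    |∏ i ∈ s, a i - ∏ i ∈ s, b i| ≤ ∑ i ∈ s, |a i - b i| := by
  classical
  induction s using Finset.induction_on with
  | empty => simp
  | insert i s hi ih =>
    rw [Finset.prod_insert hi, Finset.prod_insert hi, Finset.sum_insert hi]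
    have ih' := ih (fun j hj => ha j (Finset.mem_insert_of_mem hj))
      (fun j hj => hb j (Finset.mem_insert_of_mem hj))
    obtain ⟨ha0, ha1⟩ := ha i (Finset.mem_insert_self _ _)
    have hB0 : 0 ≤ ∏ j ∈ s, b j :=
      Finset.prod_nonneg fun j hj => (hb j (Finset.mem_insert_of_mem hj)).1
    have hB1 : ∏ j ∈ s, b j ≤ 1 := Finset.prod_le_one
      (fun j hj => (hb j (Finset.mem_insert_of_mem hj)).1)
      (fun j hj => (hb j (Finset.mem_insert_of_mem hj)).2)
    calc _ = |(a i - b i) * ∏ j ∈ s, b j + a i * (∏ j ∈ s, a j - ∏ j ∈ s, b j)| := by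
          congr 1; ring
      _ ≤ |a i - b i| * 1 + 1 * ∑ j ∈ s, |a j - b j| := by
          refine (abs_add_le _ _).trans ?_
          rw [abs_mul, abs_mul, abs_of_nonneg hB0, abs_of_nonneg ha0]
          gcongr
      _ = _ := by ring

/-! ### Points joined to a block of a typical tuple -/

/-- Every entry of `z` is adjacent to every `y b` with `b ∈ B`. -/
def IsJoined {V σ ι : Type*} (G : SimpleGraph V) (y : σ → V) (B : Finset σ) (z : ι → V) : Prop :=
  ∀ u, ∀ b ∈ B, G.Adj (y b) (z u)

open Classical in
/-- The points joined to `B` form a box, the product of the common neighbourhoods of `B`. -/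
theorem IsTypical.abs_card_filter_isJoined_sub_le {V σ ι : Type*} [DecidableEq σ]
    [Fintype ι] [DecidableEq ι]
    {G : SimpleGraph V} [DecidableRel G.Adj] {Z : ι → Finset V} {n : ℕ} (hn : 0 < n)
    (hZ : ∀ u, (Z u).card = n) {δ : ι → ℝ} (hδ : ∀ u, 0 ≤ δ u ∧ δ u ≤ 1) {τ : ℝ} {y : σ → V}
    (h : IsTypical G Z δ (τ * n) y) (B : Finset σ) :
    |(((Fintype.piFinset Z).filter (IsJoined G y B)).card : ℝ) -
      (∏ u, δ u ^ B.card) * n ^ Fintype.card ι| ≤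
      Fintype.card ι * (B.card * τ) * n ^ Fintype.card ι := by
  have hn' : (0 : ℝ) < n := by exact_mod_cast hn
  have h1 : (Fintype.piFinset Z).filter (IsJoined G y B) =
      Fintype.piFinset fun u => commonNbhd G (Z u) y B := by
    ext z
    simp only [Finset.mem_filter, Fintype.mem_piFinset, mem_commonNbhd, IsJoined, forall_and]
  have h2 : (((Fintype.piFinset Z).filter (IsJoined G y B)).card : ℝ) =
      (∏ u, ((commonNbhd G (Z u) y B).card / n : ℝ)) * n ^ Fintype.card ι := by
    rw [h1, Fintype.card_piFinset, Finset.prod_div_distrib, Finset.prod_const, Finset.card_univ]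
    push_cast
    field_simp
  rw [h2, ← sub_mul, abs_mul, abs_of_nonneg (by positivity : (0 : ℝ) ≤ n ^ Fintype.card ι)]
  refine mul_le_mul_of_nonneg_right ?_ (by positivity)
  refine (abs_prod_sub_prod_le _ _ _ (fun u _ => ⟨by positivity, ?_⟩)
    fun u _ => ⟨pow_nonneg (hδ u).1 _, pow_le_one₀ (hδ u).1 (hδ u).2⟩).trans ?_
  · rw [div_le_one hn', ← hZ u]
    exact_mod_cast Finset.card_le_card (commonNbhd_subset _ _ _ _)
  · rw [← Finset.card_univ, ← nsmul_eq_mul]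
    refine Finset.sum_le_card_nsmul _ _ _ fun u _ => ?_
    have h3 := h.abs_card_commonNbhd_sub_le u (hδ u).1 (hδ u).2 B
    rw [hZ] at h3
    have h4 : ((commonNbhd G (Z u) y B).card / n : ℝ) - δ u ^ B.card =
        ((commonNbhd G (Z u) y B).card - δ u ^ B.card * n) / n := by field_simp
    rw [h4, abs_div, abs_of_pos hn', div_le_iff₀ hn']
    linarith

open Classical in
/-- The points of the product of the sets `Z u` that are joined to none of the blocks `B k`. -/
noncomputable def unjoined {V σ ι κ : Type*} [Fintype ι] [DecidableEq ι] (G : SimpleGraph V)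
    (Z : ι → Finset V) (y : σ → V) (B : κ → Finset σ) : Finset (ι → V) :=
  (Fintype.piFinset Z).filter fun z => ∀ k, ¬ IsJoined G y (B k) z

open Classical in
theorem mem_unjoined {V σ ι κ : Type*} [Fintype ι] [DecidableEq ι] {G : SimpleGraph V}
    {Z : ι → Finset V} {y : σ → V} {B : κ → Finset σ} {z : ι → V} :
    z ∈ unjoined G Z y B ↔ z ∈ Fintype.piFinset Z ∧ ∀ k, ¬ IsJoined G y (B k) z :=
  Finset.mem_filter

open Classical in
/-- For a typical tuple, few points are joined to none of many disjoint blocks. This is Chebyshev's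
inequality for the number of blocks a random point is joined to: by typicality these events have
probability about `q = ∏ u, δ u ^ N` and are nearly pairwise independent. -/
theorem IsTypical.card_unjoined_le {V σ ι κ : Type*} [Fintype ι]
    [DecidableEq ι] [Fintype κ] [Fintype σ] [DecidableEq σ] {G : SimpleGraph V}
    [DecidableRel G.Adj] {Z : ι → Finset V} {n : ℕ}
    (hn : 0 < n) (hZ : ∀ u, (Z u).card = n) {δ : ι → ℝ} (hδ : ∀ u, 0 ≤ δ u ∧ δ u ≤ 1) {τ : ℝ}
    (hτ : 0 ≤ τ) {y : σ → V} (h : IsTypical G Z δ (τ * n) y) (B : κ → Finset σ) {N : ℕ}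
    (hN : ∀ k, (B k).card = N) (hB : ∀ k k', k ≠ k' → Disjoint (B k) (B k')) :
    ((unjoined G Z y B).card : ℝ) *
        (Fintype.card κ * ∏ u, δ u ^ N) ^ 2 ≤
      (Fintype.card κ + 3 * (Fintype.card κ : ℝ) ^ 2 *
        (Fintype.card ι * (Fintype.card σ * τ))) * n ^ Fintype.card ι := by
  set Ω := Fintype.piFinset Z with hΩ
  set ν : ℝ := (n : ℝ) ^ Fintype.card ι with hν
  have hΩc : (Ω.card : ℝ) = ν := by simp [hΩ, hν, Fintype.card_piFinset, hZ]
  have hν0 : 0 ≤ ν := by positivity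
  set q : ℝ := ∏ u, δ u ^ N with hq
  have hq0 : 0 ≤ q := Finset.prod_nonneg fun u _ => pow_nonneg (hδ u).1 _
  have hq1 : q ≤ 1 := Finset.prod_le_one (fun u _ => pow_nonneg (hδ u).1 _)
    fun u _ => pow_le_one₀ (hδ u).1 (hδ u).2
  set e : ℝ := Fintype.card ι * (Fintype.card σ * τ) with he
  have he0 : 0 ≤ e := by positivity
  set a : Finset σ → (ι → V) → ℝ := fun C z => if IsJoined G y C z then 1 else 0 with ha
  have hcount : ∀ C : Finset σ, |(∑ z ∈ Ω, a C z) - (∏ u, δ u ^ C.card) * ν| ≤ e * ν := by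
    intro C
    have h1 := h.abs_card_filter_isJoined_sub_le hn hZ hδ C
    have h2 : (∑ z ∈ Ω, a C z) = ((Ω.filter (IsJoined G y C)).card : ℝ) := by
      rw [Finset.card_filter]; push_cast; rfl
    rw [h2]
    refine h1.trans (mul_le_mul_of_nonneg_right ?_ hν0)
    have : (C.card : ℝ) ≤ Fintype.card σ := by exact_mod_cast Finset.card_le_univ C
    rw [he]
    gcongr
  have hpair : ∀ k k', k ≠ k' →
      ∑ z ∈ Ω, (a (B k) z - q) * (a (B k') z - q) ≤ 3 * e * ν := by
    intro k k' hkk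
    have hun : ∀ z, a (B k) z * a (B k') z = a (B k ∪ B k') z := by
      intro z
      have : IsJoined G y (B k ∪ B k') z ↔ IsJoined G y (B k) z ∧ IsJoined G y (B k') z := by
        simp only [IsJoined, Finset.mem_union, or_imp, forall_and]
      simp only [ha, this]
      split_ifs <;> first | (exfalso; tauto) | norm_num
    have hexp : ∑ z ∈ Ω, (a (B k) z - q) * (a (B k') z - q) =
        (∑ z ∈ Ω, a (B k ∪ B k') z - q ^ 2 * ν) - q * (∑ z ∈ Ω, a (B k) z - q * ν) -
          q * (∑ z ∈ Ω, a (B k') z - q * ν) := by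
      have h1 : ∀ z, (a (B k) z - q) * (a (B k') z - q) =
          a (B k ∪ B k') z - q * a (B k) z - q * a (B k') z + q ^ 2 := by
        intro z; rw [← hun]; ring
      simp only [h1, Finset.sum_add_distrib, Finset.sum_sub_distrib, ← Finset.mul_sum,
        Finset.sum_const, nsmul_eq_mul, hΩc]
      ring
    have e1 := hcount (B k ∪ B k')
    have e2 := hcount (B k)
    have e3 := hcount (B k')
    have hqq : (∏ u, δ u ^ (B k ∪ B k').card) = q ^ 2 := by
      rw [Finset.card_union_of_disjoint (hB k k' hkk), hN, hN, hq, ← Finset.prod_pow]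
      refine Finset.prod_congr rfl fun u _ => ?_
      ring
    rw [hqq] at e1
    rw [hN, ← hq] at e2 e3
    rw [hexp]
    have e2' : -(q * (∑ z ∈ Ω, a (B k) z - q * ν)) ≤ e * ν := by
      rw [← mul_neg]
      calc _ ≤ q * (e * ν) := mul_le_mul_of_nonneg_left (by linarith [(abs_le.1 e2).1]) hq0
        _ ≤ 1 * (e * ν) := mul_le_mul_of_nonneg_right hq1 (by positivity)
        _ = _ := one_mul _
    have e3' : -(q * (∑ z ∈ Ω, a (B k') z - q * ν)) ≤ e * ν := by
      rw [← mul_neg]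
      calc _ ≤ q * (e * ν) := mul_le_mul_of_nonneg_left (by linarith [(abs_le.1 e3).1]) hq0
        _ ≤ 1 * (e * ν) := mul_le_mul_of_nonneg_right hq1 (by positivity)
        _ = _ := one_mul _
    linarith [(abs_le.1 e1).2]
  have hdiag : ∀ k, ∑ z ∈ Ω, (a (B k) z - q) * (a (B k) z - q) ≤ ν := by
    intro k
    rw [← hΩc, Finset.card_eq_sum_ones]
    push_cast
    refine Finset.sum_le_sum fun z _ => ?_
    simp only [ha]
    split_ifs <;> nlinarith
  have hall : ∀ k k', ∑ z ∈ Ω, (a (B k) z - q) * (a (B k') z - q) ≤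
      (if k = k' then ν else 0) + 3 * e * ν := by
    intro k k'
    split_ifs with hk
    · subst hk
      have : 0 ≤ 3 * e * ν := by positivity
      linarith [hdiag k]
    · rw [zero_add]; exact hpair k k' hk
  have hmom : ∑ z ∈ Ω, (∑ k, (a (B k) z - q)) ^ 2 ≤
      (Fintype.card κ + 3 * (Fintype.card κ : ℝ) ^ 2 * e) * ν := by
    calc _ = ∑ k, ∑ k', ∑ z ∈ Ω, (a (B k) z - q) * (a (B k') z - q) := by
          simp only [sq, Finset.sum_mul_sum]
          rw [Finset.sum_comm]
          exact Finset.sum_congr rfl fun k _ => Finset.sum_comm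
      _ ≤ ∑ k : κ, ∑ k' : κ, ((if k = k' then ν else 0) + 3 * e * ν) :=
          Finset.sum_le_sum fun k _ => Finset.sum_le_sum fun k' _ => hall k k'
      _ = _ := by
          simp only [Finset.sum_add_distrib, Finset.sum_ite_eq, Finset.mem_univ, if_true,
            Finset.sum_const, Finset.card_univ, nsmul_eq_mul]
          ring
  refine le_trans ?_ hmom
  rw [← nsmul_eq_mul]
  refine (Finset.card_nsmul_le_sum _ _ _ fun z hz => ?_).trans
    (Finset.sum_le_sum_of_subset_of_nonneg (fun z hz => (mem_unjoined.1 hz).1)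
      fun z _ _ => sq_nonneg _)
  · have hz' := (mem_unjoined.1 hz).2
    have : ∑ k, (a (B k) z - q) = -(Fintype.card κ * q) := by
      simp [ha, hz']
    rw [this, neg_sq]

/-! ### Averaging over points -/

open Classical in
/-- If every member of every `E j` is `R`-related to a `κ`-proportion of the points, then some
point is related to half that proportion of `E j`, for half that proportion of the indices. -/
theorem exists_heavy_point {β η : Type*} {L : ℕ} (hL : 0 < L) (𝒢 : Finset β) {κ ν : ℝ}
    (hκ : 0 < κ) (hν : 0 < ν) (h𝒢 : (𝒢.card : ℝ) ≤ ν) (E : Fin L → Finset η) (R : β → η → Prop)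
    (hE : ∀ j, (E j).Nonempty)
    (hR : ∀ j, ∀ e ∈ E j, κ * ν ≤ ((𝒢.filter fun z => R z e).card : ℝ)) :
    ∃ z ∈ 𝒢, L * (κ / 2) ≤ ((Finset.univ.filter fun j =>
      κ / 2 * (E j).card ≤ (((E j).filter fun e => R z e).card : ℝ)).card : ℝ) := by
  set f : Fin L → β → ℝ := fun j z => (((E j).filter fun e => R z e).card : ℝ) / (E j).card
    with hf
  have hEpos : ∀ j, (0 : ℝ) < (E j).card := fun j => by exact_mod_cast (hE j).card_pos
  have hne : 𝒢.Nonempty := by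
    obtain ⟨e, he⟩ := hE ⟨0, hL⟩
    have h1 : 0 < ((𝒢.filter fun z => R z e).card : ℝ) := (mul_pos hκ hν).trans_le (hR _ e he)
    exact (Finset.card_pos.1 (by exact_mod_cast h1)).mono (Finset.filter_subset _ _)
  have hj : ∀ j, κ * ν ≤ ∑ z ∈ 𝒢, f j z := by
    intro j
    rw [hf, ← Finset.sum_div, le_div_iff₀ (hEpos j)]
    have h1 : ∑ z ∈ 𝒢, (((E j).filter fun e => R z e).card : ℝ) =
        ∑ e ∈ E j, ((𝒢.filter fun z => R z e).card : ℝ) := by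
      simp only [Finset.card_filter]
      push_cast
      exact Finset.sum_comm
    rw [h1, mul_comm, ← nsmul_eq_mul]
    exact Finset.card_nsmul_le_sum _ _ _ (hR j)
  obtain ⟨z, hz, hle⟩ : ∃ z ∈ 𝒢, L * κ ≤ ∑ j, f j z := by
    refine Finset.exists_le_of_sum_le hne ?_
    rw [Finset.sum_comm, Finset.sum_const, nsmul_eq_mul]
    calc (𝒢.card : ℝ) * (L * κ) ≤ ν * (L * κ) := by gcongr
      _ = ∑ _j : Fin L, κ * ν := by simp; ring
      _ ≤ _ := Finset.sum_le_sum fun j _ => hj j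
  refine ⟨z, hz, ?_⟩
  have hb : ∀ j, f j z ≤
      (if κ / 2 * (E j).card ≤ (((E j).filter fun e => R z e).card : ℝ) then 1 else 0) + κ / 2 := by
    intro j
    split_ifs with h
    · have : f j z ≤ 1 := by
        rw [hf, div_le_one (hEpos j)]
        exact_mod_cast Finset.card_le_card (Finset.filter_subset _ _)
      linarith
    · rw [zero_add, hf, div_le_iff₀ (hEpos j)]
      exact (not_le.1 h).le
  have h2 := hle.trans (Finset.sum_le_sum fun j _ => hb j)
  rw [Finset.sum_add_distrib, Finset.sum_boole] at h2
  simp only [Finset.sum_const, Finset.card_univ, Fintype.card_fin, nsmul_eq_mul] at h2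
  linarith

/-! ### Configurations joined to an edge -/

/-- Both ends of `e` are adjacent to every entry of `z`. -/
def EndsJoined {V ι : Type*} (G : SimpleGraph V) (z : ι → V) (e : Sym2 V) : Prop :=
  ∀ v ∈ e, ∀ u, G.Adj v (z u)

open Classical in
/-- The points of the product of the sets `Z u` that span all edges prescribed by `H`, have
distinct coordinates and are joined to one of the blocks `B k`. -/
noncomputable def configurations {V σ ι κ : Type*} [Fintype ι] [DecidableEq ι]
    (G : SimpleGraph V) (Z : ι → Finset V) (H : Finset (ι × ι)) (y : σ → V)
    (B : κ → Finset σ) : Finset (ι → V) :=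
  (Fintype.piFinset Z).filter fun z => (∀ q ∈ H, G.Adj (z q.1) (z q.2)) ∧
    Function.Injective z ∧ ∃ k, IsJoined G y (B k) z

open Classical in
theorem mem_configurations {V σ ι κ : Type*} [Fintype ι] [DecidableEq ι] {G : SimpleGraph V}
    {Z : ι → Finset V} {H : Finset (ι × ι)} {y : σ → V} {B : κ → Finset σ} {z : ι → V} :
    z ∈ configurations G Z H y B ↔ z ∈ Fintype.piFinset Z ∧
      (∀ q ∈ H, G.Adj (z q.1) (z q.2)) ∧ Function.Injective z ∧ ∃ k, IsJoined G y (B k) z :=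
  Finset.mem_filter

open Classical in
/-- If the ends of the edge `ab` have at least `g n` common neighbours in each `Z u`, then a positive
proportion of all points are configurations joined to both ends: the counting lemma in the box of
common neighbourhoods gives a proportion of about `θ`, and by assumption neither the points with a
repeated coordinate nor the unjoined points use up more than `θ / 4` of it. -/
theorem le_card_filter_of_common_nbhd {V ι κ σ : Type*} [Fintype ι]
    [DecidableEq ι] {G : SimpleGraph V} [DecidableRel G.Adj] {Z : ι → Finset V} {n : ℕ} (hn : 0 < n)
    (hZ : ∀ u, (Z u).card = n) {δ : ι → ι → ℝ} {ε d g θ : ℝ} (hε : 0 ≤ ε) (hd : 0 ≤ d)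
    (hd1 : d ≤ 1) (hg : 0 ≤ g) (H : Finset (ι × ι))
    (hirr : ∀ u v, (u, v) ∈ H → u ≠ v ∧ (v, u) ∉ H)
    (hδ : ∀ u v, (u, v) ∈ H → d ≤ δ u v ∧ δ u v ≤ 1)
    (hcut : ∀ u v, (u, v) ∈ H → HasCutBound G (Z u) (Z v) (δ u v) (ε * n ^ 2))
    (hθ : θ = d ^ (Fintype.card ι ^ 2) * g ^ Fintype.card ι)
    (hεθ : Fintype.card ι ^ 2 * ε ≤ θ / 4) (hnθ : Fintype.card ι ^ 2 ≤ θ / 4 * n)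
    {y : σ → V} {B : κ → Finset σ}
    (hB : ((unjoined G Z y B).card : ℝ) ≤ θ / 4 * n ^ Fintype.card ι)
    {a b : V}
    (hab : ∀ u, g * n ≤ (((Z u).filter fun v => G.Adj a v ∧ G.Adj b v).card : ℝ)) :
    θ / 4 * n ^ Fintype.card ι ≤
      (((configurations G Z H y B).filter fun z => EndsJoined G z s(a, b)).card : ℝ) := by
  have hn' : (0 : ℝ) < n := by exact_mod_cast hn
  set Ω := Fintype.piFinset Z with hΩ
  set ν : ℝ := (n : ℝ) ^ Fintype.card ι with hν
  have hν0 : 0 ≤ ν := by positivity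
  set W : ι → Finset V := fun u => (Z u).filter fun v => G.Adj a v ∧ G.Adj b v with hW
  have hHc : (H.card : ℝ) ≤ Fintype.card ι ^ 2 := by
    have := Finset.card_le_univ H
    rw [Fintype.card_prod, ← sq] at this
    exact_mod_cast this
  have hcount := abs_card_filter_sub_le G Z W hn hZ (fun u => Finset.filter_subset _ _) δ H hirr
    (fun u v h => ⟨hd.trans (hδ u v h).1, (hδ u v h).2⟩) hcut
  have hmain : θ * ν ≤ (∏ q ∈ H, δ q.1 q.2) * ∏ u, ((W u).card : ℝ) := by
    have h1 : d ^ (Fintype.card ι ^ 2) ≤ ∏ q ∈ H, δ q.1 q.2 := by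
      calc d ^ (Fintype.card ι ^ 2) ≤ d ^ H.card :=
            pow_le_pow_of_le_one hd hd1 (by exact_mod_cast hHc)
        _ = ∏ _q ∈ H, d := by simp
        _ ≤ _ := Finset.prod_le_prod (fun _ _ => hd) fun q hq => (hδ q.1 q.2 hq).1
    have h2 : g ^ Fintype.card ι * ν ≤ ∏ u, ((W u).card : ℝ) := by
      calc g ^ Fintype.card ι * ν = ∏ _u : ι, g * n := by simp [hν, mul_pow]
        _ ≤ _ := Finset.prod_le_prod (fun _ _ => by positivity) fun u _ => hab u
    rw [hθ, mul_assoc]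
    exact mul_le_mul h1 h2 (by positivity) ((pow_nonneg hd _).trans h1)
  have hinj : ((Ω.filter fun z => ¬ Function.Injective z).card : ℝ) ≤ θ / 4 * ν := by
    have h1 : (n : ℝ) * (Ω.filter fun z => ¬ Function.Injective z).card ≤
        Fintype.card ι ^ 2 * ν := by
      have := card_filter_not_injective_le Z hZ
      have h2 : (Ω.filter fun z => ¬ Function.Injective z).card =
        ((Fintype.piFinset Z).filter fun z => ¬ Function.Injective z).card := by congr!
      rw [h2, hν]
      exact_mod_cast this
    refine le_of_mul_le_mul_left (h1.trans ?_) hn'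
    calc _ ≤ θ / 4 * n * ν := by gcongr
      _ = _ := by ring
  have hHε : H.card * ε * ν ≤ θ / 4 * ν :=
    mul_le_mul_of_nonneg_right ((mul_le_mul_of_nonneg_right hHc hε).trans hεθ) hν0
  set 𝒜 := Ω.filter fun z => (∀ u, z u ∈ W u) ∧ ∀ q ∈ H, G.Adj (z q.1) (z q.2) with h𝒜
  have h𝒜c : 3 * (θ / 4 * ν) ≤ (𝒜.card : ℝ) := by
    have h1 := (abs_le.1 hcount).1
    have h2 : 𝒜.card = (Ω.filter fun z => (∀ u, z u ∈ W u) ∧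
      ∀ q ∈ H, G.Adj (z q.1) (z q.2)).card := by congr!
    have h3 : (𝒜.card : ℝ) - (∏ q ∈ H, δ q.1 q.2) * ∏ u, ((W u).card : ℝ) ≥
        -(H.card * ε * ν) := by
      rw [h2]; convert h1
    linarith
  have hsub : 𝒜 ⊆ ((configurations G Z H y B).filter fun z => EndsJoined G z s(a, b)) ∪
      ((Ω.filter fun z => ¬ Function.Injective z) ∪ unjoined G Z y B) := by
    intro z hz
    obtain ⟨hzΩ, hzW, hzH⟩ := Finset.mem_filter.1 hz
    by_cases h1 : Function.Injective z
    · by_cases h2 : ∃ k, IsJoined G y (B k) z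
      · refine Finset.mem_union_left _ (Finset.mem_filter.2
          ⟨mem_configurations.2 ⟨hzΩ, hzH, h1, h2⟩, fun v hv u => ?_⟩)
        have hab' := (Finset.mem_filter.1 (hzW u)).2
        rcases Sym2.mem_iff.1 hv with rfl | rfl
        exacts [hab'.1, hab'.2]
      · exact Finset.mem_union_right _ (Finset.mem_union_right _
          (mem_unjoined.2 ⟨hzΩ, not_exists.1 h2⟩))
    · exact Finset.mem_union_right _ (Finset.mem_union_left _ (Finset.mem_filter.2 ⟨hzΩ, h1⟩))
  have hle := (Finset.card_le_card hsub).trans ((Finset.card_union_le _ _).trans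
    (Nat.add_le_add_left (Finset.card_union_le _ _) _))
  have hle' : (𝒜.card : ℝ) ≤ _ := Nat.cast_le.2 hle
  push_cast at hle'
  linarith

/-! ### Assembling a good family -/

/-- A subset of the edges has no more endpoints, so its average degree drops at most by the
proportion of edges that are kept. -/
theorem mul_avgDegree_le {V : Type*} [Fintype V] [DecidableEq V] {D E : Finset (Sym2 V)}
    (hDE : D ⊆ E) {c : ℝ} (hc : c * E.card ≤ D.card) (hc0 : 0 ≤ c) :
    c * avgDegree E ≤ avgDegree D := by
  have hsub : endpoints D ⊆ endpoints E := by
    intro v hv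
    simp only [endpoints, Finset.mem_filter, Finset.mem_univ, true_and] at hv ⊢
    obtain ⟨e, he, hve⟩ := hv
    exact ⟨e, hDE he, hve⟩
  rcases D.eq_empty_or_nonempty with rfl | ⟨e, he⟩
  · have h0 : c * (E.card : ℝ) = 0 := le_antisymm (by simpa using hc) (by positivity)
    have h1 : c * avgDegree E = 0 := by
      rw [avgDegree, ← mul_div_assoc, mul_left_comm, h0]; simp
    rw [h1, avgDegree]; simp
  · have hpos : 0 < (endpoints D).card := by
      induction e with
      | h x y =>
        exact Finset.card_pos.2 ⟨x, Finset.mem_filter.2 ⟨Finset.mem_univ _, s(x, y), he, by simp⟩⟩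
    have hpos' : (0 : ℝ) < (endpoints D).card := by exact_mod_cast hpos
    have hcard : ((endpoints D).card : ℝ) ≤ (endpoints E).card := by
      exact_mod_cast Finset.card_le_card hsub
    rw [avgDegree, avgDegree, ← mul_div_assoc]
    refine div_le_div₀ (by positivity) (by linarith) hpos' hcard

open Classical in
/-- A block `k` of the enumeration `y`, a configuration `z` joined to it and `ℓ` indices `φ i` for
which a `c`-proportion of `E (φ i)` has both ends joined to `z` yield a good family. Its set `S_I`
is the part of the block in the set with index `φ(I)`, because `φ i ∈ φ(I)` if and only if
`i ∈ I`; its sets `S'_j` are read off from `z`. -/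
theorem exists_isGood_of_selection {V : Type*} [Fintype V] [DecidableEq V] {G : SimpleGraph V}
    [DecidableRel G.Adj] {r ℓ t C L m : ℕ} {α c A : ℝ} {X Y : Finset V}
    {Z : Fin (r - 3) → Finset V} (hYZ : ∀ j, Disjoint Y (Z j))
    {y : Finset (Fin L) × Fin m × Fin t → V} (hy : Function.Injective y) (hyY : ∀ b, y b ∈ Y)
    {E : Fin L → Finset (Sym2 V)}
    (hEX : ∀ j, ∀ e ∈ E j, e ∈ G.edgeSet ∧ ∀ v ∈ e, v ∈ X)
    (hA : ∀ j, A ≤ avgDegree (E j))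
    (hE : ∀ j, ∀ e ∈ E j, ∃ a b, e = s(a, b) ∧
      ∀ J k i, (j ∈ J → G.Adj a (y (J, k, i))) ∧ (j ∉ J → G.Adj b (y (J, k, i))))
    {z : Fin (r - 3) × Fin t → V} (hz : Function.Injective z) (hzZ : ∀ u, z u ∈ Z u.1)
    (hzadj : ∀ u v, u.1 ≠ v.1 → G.Adj (z u) (z v))
    {k : Fin m} (hk : ∀ J i u, G.Adj (y (J, k, i)) (z u)) (φ : Fin ℓ ↪ Fin L) (hc : 0 ≤ c)
    (hφ : ∀ i, c * (E (φ i)).card ≤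
      (((E (φ i)).filter (EndsJoined G z)).card : ℝ))
    (hcA : ((2 : ℝ) ^ ℓ)⁻¹ * α * C ≤ c * A) :
    ∃ S ∈ properFamilies G r ℓ t (Y ∪ Finset.univ.biUnion Z),
      IsGood G r ℓ t C α X (Y ∪ Finset.univ.biUnion Z) S := by
  let S : Family V r ℓ := Sum.elim
    (fun I => Finset.univ.image fun i => y (I.map φ, k, i))
    (fun j => Finset.univ.image fun i => z (j, i))
  have hSl : ∀ I v, v ∈ S (Sum.inl I) ↔ ∃ i, y (I.map φ, k, i) = v := by
    intro I v; simp [S]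
  have hSr : ∀ j v, v ∈ S (Sum.inr j) ↔ ∃ i, z (j, i) = v := by
    intro I v; simp [S]
  have hcross : ∀ b u, y b ≠ z u := fun b u h =>
    Finset.disjoint_left.1 (hYZ u.1) (hyY b) (h ▸ hzZ u)
  have hproper : S ∈ properFamilies G r ℓ t (Y ∪ Finset.univ.biUnion Z) := by
    refine ⟨?_, ?_, ?_, ?_⟩
    · rintro (I | j)
      · refine ⟨fun v hv => ?_, ?_⟩
        · obtain ⟨i, rfl⟩ := (hSl I v).1 hv
          exact Finset.mem_union_left _ (hyY _)
        · change (Finset.univ.image _).card = t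
          rw [Finset.card_image_of_injective, Finset.card_univ, Fintype.card_fin]
          intro i i' h
          simpa using hy h
      · refine ⟨fun v hv => ?_, ?_⟩
        · obtain ⟨i, rfl⟩ := (hSr j v).1 hv
          exact Finset.mem_union_right _
            (Finset.mem_biUnion.2 ⟨j, Finset.mem_univ _, hzZ (j, i)⟩)
        · change (Finset.univ.image _).card = t
          rw [Finset.card_image_of_injective, Finset.card_univ, Fintype.card_fin]
          intro i i' h
          simpa using hz h
    · rintro (I | j) (I' | j') hne
      · refine Finset.disjoint_left.2 fun v hv hv' => ?_
        obtain ⟨i, rfl⟩ := (hSl I v).1 hv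
        obtain ⟨i', h⟩ := (hSl I' _).1 hv'
        have h1 := congrArg Prod.fst (hy h)
        exact hne (congrArg Sum.inl (Finset.map_injective φ h1).symm)
      · refine Finset.disjoint_left.2 fun v hv hv' => ?_
        obtain ⟨i, rfl⟩ := (hSl I v).1 hv
        obtain ⟨i', h⟩ := (hSr j' _).1 hv'
        exact hcross _ _ h.symm
      · refine Finset.disjoint_left.2 fun v hv hv' => ?_
        obtain ⟨i, rfl⟩ := (hSr j v).1 hv
        obtain ⟨i', h⟩ := (hSl I' _).1 hv'
        exact hcross _ _ h
      · refine Finset.disjoint_left.2 fun v hv hv' => ?_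
        obtain ⟨i, rfl⟩ := (hSr j v).1 hv
        obtain ⟨i', h⟩ := (hSr j' _).1 hv'
        have h1 := congrArg Prod.fst (hz h)
        exact hne (congrArg Sum.inr h1.symm)
    · intro I j v hv w hw
      obtain ⟨i, rfl⟩ := (hSl I v).1 hv
      obtain ⟨i', rfl⟩ := (hSr j w).1 hw
      exact hk _ _ _
    · intro j j' hne v hv w hw
      obtain ⟨i, rfl⟩ := (hSr j v).1 hv
      obtain ⟨i', rfl⟩ := (hSr j' w).1 hw
      exact hzadj _ _ hne
  refine ⟨S, hproper, hproper,
    fun i => (E (φ i)).filter (EndsJoined G z), ?_, ?_, ?_⟩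
  · intro j e he
    exact hEX _ e (Finset.mem_filter.1 he).1
  · intro j
    refine hcA.trans ((mul_le_mul_of_nonneg_left (hA (φ j)) hc).trans ?_)
    exact mul_avgDegree_le (Finset.filter_subset _ _) (hφ j) hc
  · intro e he i
    obtain ⟨he1, he2⟩ := Finset.mem_filter.1 (he i)
    obtain ⟨a, b, hab, hadj⟩ := hE _ _ he1
    refine ⟨a, b, hab, ?_, ?_, ?_⟩
    · intro j v hv
      obtain ⟨i', rfl⟩ := (hSr j v).1 hv
      exact ⟨he2 a (by simp [hab]) _, he2 b (by simp [hab]) _⟩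
    · intro I hI v hv
      obtain ⟨i', rfl⟩ := (hSl I v).1 hv
      exact (hadj _ k i').1 (Finset.mem_map_of_mem φ hI)
    · intro I hI v hv
      obtain ⟨i', rfl⟩ := (hSl I v).1 hv
      exact (hadj _ k i').2 fun h => hI ((Finset.mem_map' φ).1 h)

/-! ### A typical good family -/

/-- `y` lists the vertices of the sets `S_I` without repetition, those of each `S_I` in `m`
consecutive blocks of `t` vertices. -/
def Enumerates {V : Type*} {r L m t : ℕ} (y : Finset (Fin L) × Fin m × Fin t → V)
    (S : Family V r L) : Prop :=
  Function.Injective y ∧ ∀ I v, v ∈ S (Sum.inl I) ↔ ∃ k i, y (I, k, i) = v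

theorem exists_enumerates {V : Type*} {G : SimpleGraph V} {r L m t : ℕ} {Y : Finset V}
    {S : Family V r L} (hS : S ∈ properFamilies G r L (m * t) Y) :
    ∃ y : Finset (Fin L) × Fin m × Fin t → V, Enumerates y S := by
  obtain ⟨hcard, hdisj, -, -⟩ := hS
  let e : ∀ I, S (Sum.inl I) ≃ Fin (m * t) := fun I =>
    (S (Sum.inl I)).equivFinOfCardEq (hcard (Sum.inl I)).2
  refine ⟨fun b => ((e b.1).symm (finProdFinEquiv b.2) : V), ?_, ?_⟩
  · rintro ⟨I, k⟩ ⟨I', k'⟩ h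
    simp only at h
    have hI : I = I' := by
      by_contra hne
      have h1 := ((e I).symm (finProdFinEquiv k)).2
      have h2 := ((e I').symm (finProdFinEquiv k')).2
      rw [← h] at h2
      exact Finset.disjoint_left.1 (hdisj _ _ fun hh => hne (Sum.inl_injective hh)) h1 h2
    subst hI
    have := finProdFinEquiv.injective ((e I).symm.injective (Subtype.ext h))
    rw [this]
  · intro I v
    constructor
    · intro hv
      obtain ⟨⟨k, i⟩, h⟩ := finProdFinEquiv.surjective (e I ⟨v, hv⟩)
      exact ⟨k, i, by simp only [h, Equiv.symm_apply_apply]⟩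
    · rintro ⟨k, i, rfl⟩
      exact ((e I).symm _).2

open Classical in
/-- When `r = 3` there are no sets `S'_j`, so an enumeration determines the family. Hence if every
good family had only atypical enumerations, there would be no more good families than atypical
tuples. -/
theorem exists_isTypical_isGood {V ι : Type*} [Fintype V] [DecidableEq V] {G : SimpleGraph V}
    [DecidableRel G.Adj] {L m t C : ℕ} {α τ : ℝ} {X Y : Finset V} {Z : ι → Finset V}
    {δ : ι → ℝ} (hY : Y.Nonempty) (hdense : IsDense G 3 L (m * t) C α X Y)
    (hfew : (((Fintype.piFinset fun _ : Finset (Fin L) × Fin m × Fin t => Y).filter fun y =>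
      ¬ IsTypical G Z δ τ y).card : ℝ) <
        ((2 : ℝ) ^ L)⁻¹ * α * (Y.card : ℝ) ^ (2 ^ L * (m * t))) :
    ∃ (S : Family V 3 L) (y : Finset (Fin L) × Fin m × Fin t → V),
      IsGood G 3 L (m * t) C α X Y S ∧ Enumerates y S ∧ IsTypical G Z δ τ y := by
  by_contra hcon
  push Not at hcon
  set T := {S : Family V 3 L | S ∈ properFamilies G 3 L (m * t) Y ∧
    IsGood G 3 L (m * t) C α X Y S} with hT
  have : Nonempty (Finset (Fin L) × Fin m × Fin t → V) := ⟨fun _ => hY.choose⟩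
  have hex : ∀ S : Family V 3 L, S ∈ T →
      ∃ y : Finset (Fin L) × Fin m × Fin t → V, Enumerates y S :=
    fun S hS => exists_enumerates hS.1
  choose! f hf using hex
  have hle : T.ncard ≤ Set.ncard (SetLike.coe
      ((Fintype.piFinset fun _ : Finset (Fin L) × Fin m × Fin t => Y).filter
        fun y => ¬ IsTypical G Z δ τ y)) := by
    refine Set.ncard_le_ncard_of_injOn f ?_ ?_ (Finset.finite_toSet _)
    · intro S hS
      refine Finset.mem_coe.2 (Finset.mem_filter.2 ⟨Fintype.mem_piFinset.2 fun b => ?_,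
        hcon S (f S) hS.2 (hf S hS)⟩)
      exact (hS.1.1 (Sum.inl b.1)).1 (((hf S hS).2 b.1 _).2 ⟨b.2.1, b.2.2, rfl⟩)
    · intro S hS S' hS' h
      funext j
      rcases j with I | j
      · ext v
        rw [(hf S hS).2, (hf S' hS').2, h]
      · exact Fin.elim0 j
  rw [Set.ncard_coe_finset] at hle
  have hd : ((2 : ℝ) ^ L)⁻¹ * α * (Y.card : ℝ) ^ ((2 ^ L + (3 - 3)) * (m * t)) ≤ (T.ncard : ℝ) :=
    hdense
  have hle' : (T.ncard : ℝ) ≤ _ := Nat.cast_le.2 hle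
  simp only [Nat.sub_self, add_zero] at hd
  linarith

/-- A typical good family for `r = 3` yields a good family for `r`. The constants: `d` bounds the
densities and `g` the relative codegrees from below; `θ` bounds from below the probability that a
random point spans all required edges and is joined to both ends of a given edge, and `q` the
probability that it is joined to a given block of the typical tuple. -/
theorem exists_isGood_of_isTypical {V : Type*} [Fintype V] [DecidableEq V] {G : SimpleGraph V}
    [DecidableRel G.Adj] {r ℓ t C Cs L m : ℕ} {α τ ε d g θ q : ℝ} {X Y : Finset V}
    {Z : Fin (r - 3) → Finset V} (hL : 0 < L) (hm : 0 < m) (hα : 0 < α) (hCs : 0 < Cs)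
    (hYZ : ∀ j, Disjoint Y (Z j))
    {n : ℕ} (hn : 0 < n) (hYn : Y.card = n)
    (hZn : ∀ j, (Z j).card = n) {δ : Fin (r - 3) → ℝ} (hδ : ∀ j, d ≤ δ j ∧ δ j ≤ 1)
    {δ' : Fin (r - 3) → Fin (r - 3) → ℝ} (hδ' : ∀ i j, i ≠ j → d ≤ δ' i j ∧ δ' i j ≤ 1)
    (hcut : ∀ i j, i ≠ j → HasCutBound G (Z i) (Z j) (δ' i j) (ε * n ^ 2))
    (hε : 0 ≤ ε) (hd : 0 < d) (hd1 : d ≤ 1) (hg : 0 < g) (hτ : 0 ≤ τ)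
    (hθ : θ = d ^ ((Fintype.card (Fin (r - 3) × Fin t)) ^ 2) *
      g ^ Fintype.card (Fin (r - 3) × Fin t))
    (hq : q = d ^ (2 ^ L * t * Fintype.card (Fin (r - 3) × Fin t)))
    (hεθ : (Fintype.card (Fin (r - 3) × Fin t) : ℝ) ^ 2 * ε ≤ θ / 4)
    (hmθ : (Fintype.card (Fin (r - 3) × Fin t) : ℝ) ^ 2 ≤ θ / 4 * (m * t))
    (hmq : 8 ≤ m * (θ * q ^ 2))
    (hτq : 3 * ((Fintype.card (Fin (r - 3) × Fin t) : ℝ) *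
      (Fintype.card (Finset (Fin L) × Fin m × Fin t) * τ)) ≤ θ * q ^ 2 / 8)
    (hLθ : ℓ ≤ L * (θ / 8))
    (hC : ((2 : ℝ) ^ ℓ)⁻¹ * α * C ≤ θ / 8 * (((2 : ℝ) ^ L)⁻¹ * α * Cs))
    (hdeg : ∀ a ∈ X, ∀ b ∈ X, ∀ j,
      g * n ≤ (((Z j).filter fun v => G.Adj a v ∧ G.Adj b v).card : ℝ))
    {S : Family V 3 L} {y : Finset (Fin L) × Fin m × Fin t → V}
    (hS : IsGood G 3 L (m * t) Cs α X Y S) (hyS : Enumerates y S)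
    (hy : IsTypical G (fun u : Fin (r - 3) × Fin t => Z u.1) (fun u => δ u.1) (τ * n) y) :
    ∃ S ∈ properFamilies G r ℓ t (Y ∪ Finset.univ.biUnion Z),
      IsGood G r ℓ t C α X (Y ∪ Finset.univ.biUnion Z) S := by
  classical
  obtain ⟨⟨hSY, -, -, -⟩, E, hEX, hEA, hES⟩ := hS
  obtain ⟨hyinj, hySI⟩ := hyS
  set K := Fintype.card (Fin (r - 3) × Fin t) with hK
  set A : ℝ := ((2 : ℝ) ^ L)⁻¹ * α * Cs with hA
  have hθ0 : 0 < θ := by rw [hθ]; positivity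
  have hq0 : 0 < q := by rw [hq]; positivity
  have hA0 : 0 < A := by
    have : (0 : ℝ) < Cs := by exact_mod_cast hCs
    positivity
  set ν : ℝ := (n : ℝ) ^ K with hν
  have hn' : (0 : ℝ) < n := by exact_mod_cast hn
  have hm' : (0 : ℝ) < m := by exact_mod_cast hm
  have hν0 : 0 < ν := by positivity
  have hyY : ∀ b, y b ∈ Y := fun b =>
    (hSY (Sum.inl b.1)).1 ((hySI b.1 _).2 ⟨b.2.1, b.2.2, rfl⟩)
  -- `Y` contains the `m * t` vertices of a single set `S_I`, so repeated coordinates are rare.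
  have hmtn : m * t ≤ n := by
    rw [← (hSY (Sum.inl ∅)).2, ← hYn]
    exact Finset.card_le_card (hSY (Sum.inl ∅)).1
  have hEne : ∀ j, (E j).Nonempty := by
    intro j
    by_contra hne
    have := hEA j
    rw [Finset.not_nonempty_iff_eq_empty.1 hne, avgDegree] at this
    simp only [Finset.card_empty, Nat.cast_zero, mul_zero, zero_div] at this
    exact absurd this (not_le.2 hA0)
  -- The condition on tuples of edges splits into one condition on each `E j`, since all other
  -- entries of a tuple can be filled in.
  have hEarrow : ∀ j, ∀ e ∈ E j, ∃ a b, e = s(a, b) ∧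
      ∀ J k i, (j ∈ J → G.Adj a (y (J, k, i))) ∧ (j ∉ J → G.Adj b (y (J, k, i))) := by
    intro j e he
    have h1 := hES (Function.update (fun j => (hEne j).choose) j e) (fun j' => by
      rcases eq_or_ne j' j with rfl | hne
      · simpa using he
      · rw [Function.update_of_ne hne]; exact (hEne j').choose_spec) j
    rw [Function.update_self] at h1
    obtain ⟨a, b, hab, -, h2, h3⟩ := h1
    exact ⟨a, b, hab, fun J k i => ⟨fun hj => h2 J hj _ ((hySI J _).2 ⟨k, i, rfl⟩),
      fun hj => h3 J hj _ ((hySI J _).2 ⟨k, i, rfl⟩)⟩⟩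
  have hZn' : ∀ u : Fin (r - 3) × Fin t, (Z u.1).card = n := fun u => hZn u.1
  let B : Fin m → Finset (Finset (Fin L) × Fin m × Fin t) := fun k =>
    Finset.univ ×ˢ ({k} ×ˢ Finset.univ)
  have hBcard : ∀ k, (B k).card = 2 ^ L * t := by
    intro k; simp [B]
  have hBdisj : ∀ k k', k ≠ k' → Disjoint (B k) (B k') := by
    intro k k' hne
    refine Finset.disjoint_left.2 fun b hb hb' => hne ?_
    simp only [B, Finset.mem_product, Finset.mem_univ, Finset.mem_singleton, true_and,
      and_true] at hb hb'
    exact hb.symm.trans hb'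
  have hnone : ((unjoined G (fun u : Fin (r - 3) × Fin t => Z u.1) y B).card : ℝ) ≤
      θ / 4 * n ^ K := by
    have hδ01 : ∀ u : Fin (r - 3) × Fin t, 0 ≤ δ u.1 ∧ δ u.1 ≤ 1 :=
      fun u => ⟨hd.le.trans (hδ u.1).1, (hδ u.1).2⟩
    have h1 := IsTypical.card_unjoined_le hn hZn' hδ01 hτ hy B hBcard hBdisj
    rw [← hK, ← hν, Fintype.card_fin] at h1
    set M : ℝ := ((unjoined G (fun u : Fin (r - 3) × Fin t => Z u.1) y B).card : ℝ)
    have hqle : q ≤ ∏ u : Fin (r - 3) × Fin t, δ u.1 ^ (2 ^ L * t) := by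
      calc q = ∏ _u : Fin (r - 3) × Fin t, d ^ (2 ^ L * t) := by
            rw [hq, Finset.prod_const, Finset.card_univ, ← pow_mul]
        _ ≤ _ := Finset.prod_le_prod (fun _ _ => by positivity)
            fun u _ => pow_le_pow_left₀ hd.le (hδ u.1).1 _
    have h2 : M * (m * q) ^ 2 ≤ (m * (m * (θ * q ^ 2)) / 8 + m ^ 2 * (θ * q ^ 2 / 8)) * ν := by
      calc M * (m * q) ^ 2 ≤ M * (m * ∏ u : Fin (r - 3) × Fin t, δ u.1 ^ (2 ^ L * t)) ^ 2 := by
            gcongr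
        _ ≤ (m + 3 * (m : ℝ) ^ 2 *
            (K * (Fintype.card (Finset (Fin L) × Fin m × Fin t) * τ))) * ν := h1
        _ ≤ _ := by
          refine mul_le_mul_of_nonneg_right (add_le_add ?_ ?_) hν0.le
          · have := mul_le_mul_of_nonneg_left hmq hm'.le
            linarith
          · rw [mul_comm (3 : ℝ), mul_assoc]
            exact mul_le_mul_of_nonneg_left hτq (by positivity)
    refine le_of_mul_le_mul_right (h2.trans (le_of_eq ?_)) (by positivity : 0 < (m * q) ^ 2)
    rw [hν]; ring
  set H : Finset ((Fin (r - 3) × Fin t) × (Fin (r - 3) × Fin t)) :=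
    Finset.univ.filter fun p => p.1.1 < p.2.1 with hH
  have hHmem : ∀ u v, (u, v) ∈ H ↔ u.1 < v.1 := fun u v => by simp [hH]
  set 𝒢 := configurations G (fun u : Fin (r - 3) × Fin t => Z u.1) H y B with h𝒢
  have h𝒢c : (𝒢.card : ℝ) ≤ ν := by
    have h1 : 𝒢.card ≤ _ := Finset.card_le_card fun z hz => (mem_configurations.1 hz).1
    rw [Fintype.card_piFinset, Finset.prod_congr rfl (fun u _ => hZn u.1), Finset.prod_const,
      Finset.card_univ, ← hK] at h1
    rw [hν]
    exact_mod_cast h1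
  have hR : ∀ j, ∀ e ∈ E j, θ / 4 * ν ≤
      ((𝒢.filter fun z => EndsJoined G z e).card : ℝ) := by
    intro j e he
    obtain ⟨a, b, rfl, -⟩ := hEarrow j e he
    have hX := (hEX j _ he).2
    exact le_card_filter_of_common_nbhd hn hZn'
      hε hd.le hd1 hg.le H
      (fun u v h => by
        rw [hHmem] at h
        exact ⟨fun hh => by rw [hh] at h; exact lt_irrefl _ h,
          fun hh => lt_asymm h ((hHmem _ _).1 hh)⟩)
      (δ := fun u v => δ' u.1 v.1)
      (fun u v h => hδ' _ _ ((hHmem _ _).1 h).ne)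
      (fun u v h => hcut _ _ ((hHmem _ _).1 h).ne)
      hθ hεθ (hmθ.trans (mul_le_mul_of_nonneg_left (by exact_mod_cast hmtn) (by positivity)))
      hnone (fun u => hdeg a (hX a (by simp)) b (hX b (by simp)) u.1)
  obtain ⟨z, hz, hheavy⟩ := exists_heavy_point hL 𝒢 (by positivity : 0 < θ / 4) hν0 h𝒢c E
    (EndsJoined G) hEne hR
  obtain ⟨hzZ, hzH, hzinj, k, hk⟩ := mem_configurations.1 hz
  set J := Finset.univ.filter fun j => θ / 4 / 2 * ((E j).card : ℝ) ≤
    (((E j).filter (EndsJoined G z)).card : ℝ) with hJ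
  have hJc : ℓ ≤ J.card := by
    have : (ℓ : ℝ) ≤ J.card := by
      refine hLθ.trans (le_trans (le_of_eq ?_) hheavy)
      ring
    exact_mod_cast this
  obtain ⟨φ⟩ : Nonempty (Fin ℓ ↪ J) :=
    Function.Embedding.nonempty_of_card_le (by simpa using hJc)
  refine exists_isGood_of_selection (c := θ / 8) hYZ hyinj hyY hEX hEA hEarrow hzinj
    (Fintype.mem_piFinset.1 hzZ) ?_ (k := k) ?_ (φ.trans (Function.Embedding.subtype _))
    (by positivity) ?_ hC
  · intro u v hne
    rcases lt_or_gt_of_ne hne with h | h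
    · exact hzH (u, v) ((hHmem _ _).2 h)
    · exact (hzH (v, u) ((hHmem _ _).2 h)).symm
  · intro I i u
    exact hk u (I, k, i) (by simp [B])
  · intro i
    have h1 := (Finset.mem_filter.1 (φ i).2).2
    refine le_trans (le_of_eq ?_) h1
    change θ / 8 * ((E (φ i)).card : ℝ) = _
    ring

/-! ### The choice of constants -/

theorem le_card_filter_adj_and_adj {V : Type*} [DecidableEq V] {G : SimpleGraph V}
    [DecidableRel G.Adj] {W : Finset V} {γ : ℝ} {a b : V}
    (ha : (1 / 2 + γ) * (W.card : ℝ) ≤ ((W.filter fun v => G.Adj a v).card : ℝ))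
    (hb : (1 / 2 + γ) * (W.card : ℝ) ≤ ((W.filter fun v => G.Adj b v).card : ℝ)) :
    2 * γ * W.card ≤ ((W.filter fun v => G.Adj a v ∧ G.Adj b v).card : ℝ) := by
  have h1 := Finset.card_union_add_card_inter (W.filter fun v => G.Adj a v)
    (W.filter fun v => G.Adj b v)
  rw [← Finset.filter_and] at h1
  have h2 : ((W.filter fun v => G.Adj a v) ∪ W.filter fun v => G.Adj b v).card ≤ W.card :=
    Finset.card_le_card (Finset.union_subset (Finset.filter_subset _ _)
      (Finset.filter_subset _ _))
  have h3 : (((W.filter fun v => G.Adj a v).card + (W.filter fun v => G.Adj b v).card : ℕ) : ℝ) ≤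
      ((W.card + (W.filter fun v => G.Adj a v ∧ G.Adj b v).card : ℕ) : ℝ) := by
    rw [← h1]; exact_mod_cast Nat.add_le_add_right h2 _
  push_cast at h3
  linarith

end Zykov

theorem proposition6p5 (r ℓ t : ℕ) (hr : 3 < r) (hℓ : 0 < ℓ) (ht : 0 < t)
    (d γ : ℝ) (hd : 0 < d) (hγ : 0 < γ) :
    ∃ ℓs ts : ℕ, 0 < ℓs ∧ 0 < ts ∧
      ∀ (α : ℝ) (C : ℕ), 0 < α → 0 < C →
        ∃ (ε₁ : ℝ) (Cs : ℕ), 0 < ε₁ ∧ 0 < Cs ∧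
          ∀ ε : ℝ, 0 < ε → ε < ε₁ →
            ∀ (V : Type*) [Fintype V] [DecidableEq V] (G : SimpleGraph V) [DecidableRel G.Adj]
              (X Y : Finset V) (Z : Fin (r - 3) → Finset V),
              Disjoint X Y →
              (∀ j, Disjoint X (Z j)) →
              (∀ j, Disjoint Y (Z j)) →
              (∀ i j, i ≠ j → Disjoint (Z i) (Z j)) →
              (∀ j, Y.card = (Z j).card) →
              (∀ j, Zykov.IsRegularPair G ε d Y (Z j)) →
              (∀ i j, i ≠ j → Zykov.IsRegularPair G ε d (Z i) (Z j)) →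
              (∀ x ∈ X, ∀ j,
                (1 / 2 + γ) * ((Z j).card : ℝ) ≤ (((Z j).filter fun v => G.Adj x v).card : ℝ)) →
              Zykov.IsDense G 3 ℓs ts Cs α X Y →
              ∃ S ∈ Zykov.properFamilies G r ℓ t (Y ∪ Finset.univ.biUnion Z),
                Zykov.IsGood G r ℓ t C α X (Y ∪ Finset.univ.biUnion Z) S := by
  classical
  have hcardι : Fintype.card (Fin (r - 3) × Fin t) = (r - 3) * t := by simp
  have hKpos : 0 < Fintype.card (Fin (r - 3) × Fin t) := by
    rw [hcardι]; exact Nat.mul_pos (by omega) ht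
  set K := Fintype.card (Fin (r - 3) × Fin t) with hK
  have hK0 : (0 : ℝ) < K := by exact_mod_cast hKpos
  have hd'0 : 0 < min d 1 := lt_min hd one_pos
  have hg0 : 0 < min (2 * γ) 1 := lt_min (by linarith) one_pos
  set θ : ℝ := min d 1 ^ (K ^ 2) * min (2 * γ) 1 ^ K with hθ
  have hθ0 : 0 < θ := by positivity
  set L : ℕ := ⌈8 * ℓ / θ⌉₊ with hL
  have hLθ : (ℓ : ℝ) ≤ L * (θ / 8) := by
    have h1 : 8 * ℓ / θ ≤ (L : ℝ) := Nat.le_ceil _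
    rw [div_le_iff₀ hθ0] at h1
    linarith
  have hL0 : 0 < L := Nat.ceil_pos.2 (by positivity)
  set q : ℝ := min d 1 ^ (2 ^ L * t * K) with hq
  have hq0 : 0 < q := by positivity
  set m : ℕ := ⌈8 / (θ * q ^ 2)⌉₊ + ⌈4 * (K : ℝ) ^ 2 / θ⌉₊ with hm
  have hm1 : 8 / (θ * q ^ 2) ≤ (m : ℝ) := by
    rw [hm]; push_cast
    exact (Nat.le_ceil _).trans (le_add_of_nonneg_right (Nat.cast_nonneg _))
  have hm2 : 4 * (K : ℝ) ^ 2 / θ ≤ (m : ℝ) := by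
    rw [hm]; push_cast
    exact (Nat.le_ceil _).trans (le_add_of_nonneg_left (Nat.cast_nonneg _))
  have hm0 : 0 < m := by
    have : (0 : ℝ) < m := lt_of_lt_of_le (by positivity) hm1
    exact_mod_cast this
  refine ⟨L, m * t, hL0, Nat.mul_pos hm0 ht, fun α C hα hC => ?_⟩
  set s := Fintype.card (Finset (Fin L) × Fin m × Fin t) with hs
  have hscard : s = 2 ^ L * (m * t) := by simp [hs]
  have hs0 : (0 : ℝ) < s := by
    have : 0 < s := by rw [hscard]; positivity
    exact_mod_cast this
  set τ : ℝ := θ * q ^ 2 / (24 * K * s) with hτ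
  have hτ0 : 0 < τ := by positivity
  have hC0 : (0 : ℝ) < C := by exact_mod_cast hC
  refine ⟨min (θ / (4 * K ^ 2)) (τ * (((2 : ℝ) ^ L)⁻¹ * α) / (2 * K * 2 ^ s * s)),
    ⌈8 * 2 ^ L * C / θ⌉₊, by positivity, Nat.ceil_pos.2 (by positivity), ?_⟩
  intro ε hε hεlt V _ _ G _ X Y Z _ _ hYZ _ hcard hregY hregZ hdeg hdense
  have hε1 := hεlt.trans_le (min_le_left _ _)
  have hε2 := hεlt.trans_le (min_le_right _ _)
  set n := Y.card with hn
  have hZn : ∀ j, (Z j).card = n := fun j => (hcard j).symm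
  -- An empty `Y` would have density `0 < d` to each `Z j`.
  have hYne : Y.Nonempty := by
    by_contra hne
    have h1 := (hregY ⟨0, by omega⟩).2
    rw [Finset.not_nonempty_iff_eq_empty.1 hne] at h1
    simp only [SimpleGraph.edgeDensity_empty_left, Rat.cast_zero] at h1
    linarith
  have hn0 : 0 < n := hYne.card_pos
  have hn' : (0 : ℝ) < n := by exact_mod_cast hn0
  have hbounds : ∀ A B, Zykov.IsRegularPair G ε d A B →
      min d 1 ≤ (G.edgeDensity A B : ℝ) ∧ (G.edgeDensity A B : ℝ) ≤ 1 := fun A B h =>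
    ⟨(min_le_left _ _).trans h.2, by exact_mod_cast G.edgeDensity_le_one A B⟩
  have hcutY : ∀ u : Fin (r - 3) × Fin t,
      Zykov.HasCutBound G Y (Z u.1) (G.edgeDensity Y (Z u.1)) (ε * n ^ 2) := by
    intro u
    have := Zykov.hasCutBound_of_isUniform (hregY u.1).1 hε
    rwa [hZn, mul_assoc, ← sq] at this
  have hfew := Zykov.card_filter_not_isTypical_le (σ := Finset (Fin L) × Fin m × Fin t)
    (τ := τ * n) (by positivity) hcutY
  have hfew' : (((Fintype.piFinset fun _ : Finset (Fin L) × Fin m × Fin t => Y).filter fun y =>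
      ¬ Zykov.IsTypical G (fun u : Fin (r - 3) × Fin t => Z u.1)
        (fun u => (G.edgeDensity Y (Z u.1) : ℝ)) (τ * n) y).card : ℝ) <
        ((2 : ℝ) ^ L)⁻¹ * α * (Y.card : ℝ) ^ (2 ^ L * (m * t)) := by
    rw [← hscard]
    rw [← hs, ← hK, ← hn] at hfew
    set M : ℝ := (((Fintype.piFinset fun _ : Finset (Fin L) × Fin m × Fin t => Y).filter fun y =>
      ¬ Zykov.IsTypical G (fun u : Fin (r - 3) × Fin t => Z u.1)
        (fun u => (G.edgeDensity Y (Z u.1) : ℝ)) (τ * n) y).card : ℝ)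
    rw [lt_div_iff₀ (by positivity)] at hε2
    refine lt_of_mul_lt_mul_right ?_ (by positivity : 0 ≤ τ * n ^ 2)
    calc M * (τ * n ^ 2) = n * M * (τ * n) := by ring
      _ ≤ _ := hfew
      _ = ε * (2 * K * 2 ^ s * s) * (n ^ 2 * n ^ s) := by ring
      _ < τ * (((2 : ℝ) ^ L)⁻¹ * α) * (n ^ 2 * n ^ s) := by gcongr
      _ = _ := by ring
  obtain ⟨S, y, hS, hyS, hy⟩ := Zykov.exists_isTypical_isGood hYne hdense hfew'
  refine Zykov.exists_isGood_of_isTypical (ε := ε) (d := min d 1) (g := min (2 * γ) 1) (θ := θ)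
    (q := q) (δ := fun j => (G.edgeDensity Y (Z j) : ℝ))
    (δ' := fun i j => (G.edgeDensity (Z i) (Z j) : ℝ)) hL0 hm0 hα
    (Nat.ceil_pos.2 (by positivity)) hYZ hn0 rfl hZn
    (fun j => hbounds _ _ (hregY j)) (fun i j h => hbounds _ _ (hregZ i j h)) ?_ hε.le hd'0
    (min_le_right _ _) hg0 hτ0.le hθ hq ?_ ?_ ?_ ?_ hLθ ?_ ?_ hS hyS hy
  · intro i j h
    have := Zykov.hasCutBound_of_isUniform (hregZ i j h).1 hε
    rwa [hZn, hZn, mul_assoc, ← sq] at this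
  · rw [lt_div_iff₀ (by positivity)] at hε1
    linarith
  · rw [div_le_iff₀ hθ0] at hm2
    have ht1 : (1 : ℝ) ≤ t := by exact_mod_cast ht
    calc (K : ℝ) ^ 2 ≤ θ / 4 * m := by linarith
      _ ≤ θ / 4 * (m * t) :=
        mul_le_mul_of_nonneg_left (le_mul_of_one_le_right (Nat.cast_nonneg _) ht1) (by positivity)
  · rwa [div_le_iff₀ (by positivity)] at hm1
  · rw [← hs, ← hK, hτ]
    refine le_of_eq ?_
    field_simp
    norm_num
  · have h1 : 8 * 2 ^ L * C / θ ≤ (⌈8 * 2 ^ L * C / θ⌉₊ : ℝ) := Nat.le_ceil _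
    rw [div_le_iff₀ hθ0] at h1
    have h2 : ((2 : ℝ) ^ ℓ)⁻¹ ≤ 1 := inv_le_one_of_one_le₀ (one_le_pow₀ one_le_two)
    calc ((2 : ℝ) ^ ℓ)⁻¹ * α * C ≤ 1 * α * C := by gcongr
      _ = ((2 : ℝ) ^ L)⁻¹ * α / 8 * (8 * 2 ^ L * C) := by field_simp
      _ ≤ ((2 : ℝ) ^ L)⁻¹ * α / 8 * (⌈8 * 2 ^ L * C / θ⌉₊ * θ) :=
        mul_le_mul_of_nonneg_left h1 (by positivity)
      _ = _ := by ring
  · intro a ha b hb j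
    have h1 := Zykov.le_card_filter_adj_and_adj (hdeg a ha j) (hdeg b hb j)
    rw [hZn] at h1
    exact (mul_le_mul_of_nonneg_right (min_le_left _ _) hn'.le).trans h1
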